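/- Let $m\ge 1$ be an integer, let $\beta(s)=\sum_{n\ge 1}\frac{(-1)^{n-1}}{(2n-1)^s}$ be the Dirichlet beta function and $\zeta$ the Riemann zeta function. For integers $s_1,\dots,s_r\ge1$ and signs $\varepsilon_i,\sigma_i\in\{\pm1\}$ define the alternating multiple mixed value $$M^{\varepsilon_1,\ldots,\varepsilon_r}_{\sigma_1,\ldots,\sigma_r}(s_1,\ldots,s_r)=\sum_{m_1>\cdots>m_r>0}\ \prod_{i=1}^{r}\frac{(1+\varepsilon_i(-1)^{m_i})\,\sigma_i^{(2m_i+1-\varepsilon_i)/4}}{m_i^{s_i}},$$ whenever this converges (as the limit, for $N\to\infty$, of the sums over $m_1\le N$), and let the alternating multiple $T$-value be $T^{\sigma_1,\ldots,\sigma_r}(s_1,\ldots,s_r)=M^{\varepsilon_1,\ldots,\varepsilon_r}_{\sigma_1,\ldots,\sigma_r}(s_1,\ldots,s_r)$ with $\varepsilon_i=(-1)^{r-i+1}$ (so the parities of the $m_i$ alternate and $m_r$ is odd). A bar over $s_i$ means $\sigma_i=-1$ (otherwise $\sigma_i=1$), and $\{1\}_n$ means $1$ repeated $n$ times; thus $$T(\overline{2},\{1\}_{2m-1},\overline{1})=2^{2m+1}\sum_{\substack{n_1>n_2>\cdots>n_{2m+1}>0\\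 n_1,n_3,\ldots,n_{2m+1}\ \mathrm{odd}\\ n_2,n_4,\ldots,n_{2m}\ \mathrm{even}}}\frac{(-1)^{(n_1-1)/2}(-1)^{(n_{2m+1}-1)/2}}{n_1^2\,n_2\cdots n_{2m+1}}.$$ Then this series converges absolutely, and $$T(\overline{2},\{1\}_{2m-1},\overline{1})=\sum_{\substack{r+p+2k=2m\\ r,p,k\ge 0}}4(-1)^{r+k}\,\beta(r+1)\,\beta(p+1)\,\frac{1}{(2k)!}\Big(\frac{\pi}{2}\Big)^{2k}.$$ In particular, $T(\overline{2},\{1\}_{2m-1},\overline{1})$ lies in $\mathbb{Q}[\pi^2,\beta(2),\beta(4),\beta(6),\ldots]$, the $\mathbb{Q}$-subalgebra of $\mathbb{R}$ generated by $\pi^2$ and the values of $\beta$ at positive even integers, and hence also in $\mathbb{Q}[\pi,\zeta(2),\beta(2),\zeta(3),\beta(3),\ldots]$. -/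

import Mathlib

open Filter Topology

/-- The `m`-th term of an alternating multiple mixed value, for parities `ε`, signs `σ`,
arguments `s` (all of depth `r`). If `ε i = 1` the factor `1 + ε i (-1)^(m i)` vanishes for odd
`m i`, if `ε i = -1` it vanishes for even `m i`; whenever it does not vanish the integer division
in the exponent of `σ i` is exact. -/
noncomputable def ammvTerm {r : ℕ} (ε σ : Fin r → ℤˣ) (s : Fin r → ℕ) (m : Fin r → ℕ) : ℝ :=
  ∏ i, ((1 + ((ε i : ℤ) : ℝ) * (-1) ^ (m i)) *
    (((σ i ^ ((2 * (m i : ℤ) + 1 - (ε i : ℤ)) / 4) : ℤˣ) : ℤ) : ℝ)) / (m i : ℝ) ^ (s i)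

/-- The summation range `m₁ > m₂ > ⋯ > m_r > 0`. -/
def ammvIndex (r : ℕ) : Set (Fin r → ℕ) := {m | StrictAnti m ∧ ∀ i, 0 < m i}

open Classical in
/-- The sum of the terms with `N ≥ m₁ > m₂ > ⋯ > m_r > 0`. -/
noncomputable def ammvTrunc {r : ℕ} (ε σ : Fin r → ℤˣ) (s : Fin r → ℕ) (N : ℕ) : ℝ :=
  ∑ m ∈ (Fintype.piFinset fun _ : Fin r => Finset.Icc 1 N) with StrictAnti m, ammvTerm ε σ s m

/-- The alternating multiple mixed value `M^{ε}_{σ}(s₁,…,s_r)`, as the limit of the truncated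
sums (some of these values are only conditionally convergent). -/
noncomputable def ammv {r : ℕ} (ε σ : Fin r → ℤˣ) (s : Fin r → ℕ) : ℝ :=
  limUnder atTop (ammvTrunc ε σ s)

/-- The parities `…, ev, od, ev, od` (alternating, the last one odd), with `ev = 1`, `od = -1`. -/
def mtvParity (r : ℕ) : Fin r → ℤˣ := fun i => (-1) ^ (r - (i : ℕ))

/-- The alternating multiple `T`-value `T^{σ₁,…,σ_r}(s₁,…,s_r)`. -/
noncomputable def mtv {r : ℕ} (σ : Fin r → ℤˣ) (s : Fin r → ℕ) : ℝ :=
  ammv (mtvParity r) σ s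

/-- The arguments of `T(2̄, {1}_{2m-1}, 1̄)`, without the bars. -/
def args211 (m : ℕ) : Fin (2 * m + 1) → ℕ := fun i => if i = 0 then 2 else 1

/-- The signs of `T(2̄, {1}_{2m-1}, 1̄)`: the first and the last argument are barred. -/
def signs211 (m : ℕ) : Fin (2 * m + 1) → ℤˣ :=
  fun i => if i = 0 ∨ i = Fin.last (2 * m) then -1 else 1

/-- The Dirichlet beta function at a natural number `s`,
`β(s) = lim_{N → ∞} ∑_{n < N} (-1)^n / (2n+1)^s`, only conditionally convergent for `s = 1`. -/
noncomputable def dirichletBeta (s : ℕ) : ℝ :=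
  limUnder atTop fun N : ℕ => ∑ n ∈ Finset.range N, (-1 : ℝ) ^ n / (2 * (n : ℝ) + 1) ^ s

/-- The series that defines `β(s)` converges for every `s ≥ 1`. -/
theorem tendsto_dirichletBeta {s : ℕ} (hs : 1 ≤ s) :
    Tendsto (fun N : ℕ => ∑ n ∈ Finset.range N, (-1 : ℝ) ^ n / (2 * (n : ℝ) + 1) ^ s) atTop
      (𝓝 (dirichletBeta s)) := by
  apply tendsto_nhds_limUnder
  have hanti : Antitone fun n : ℕ => (1 : ℝ) / (2 * (n : ℝ) + 1) ^ s := by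
    intro a b hab
    have : (a : ℝ) ≤ b := by exact_mod_cast hab
    dsimp only
    gcongr
  have hlim : Tendsto (fun n : ℕ => (1 : ℝ) / (2 * (n : ℝ) + 1) ^ s) atTop (𝓝 0) := by
    apply Tendsto.div_atTop tendsto_const_nhds
    apply (tendsto_pow_atTop (by omega)).comp
    apply tendsto_atTop_add_const_right
    exact tendsto_natCast_atTop_atTop.const_mul_atTop (by norm_num)
  obtain ⟨l, hl⟩ := hanti.tendsto_alternating_series_of_tendsto_zero hlim
  refine ⟨l, hl.congr fun N => Finset.sum_congr rfl fun n _ => ?_⟩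
  rw [mul_one_div]

/-!
Summing over all indices but the largest writes `T(2̄, {1}_{2m-1}, 1̄)` as `(-1)^m ∑ c n / n`, where
the `c n` are, up to sign, sums over chains of alternating parity. Let `F_k` be the generating
function of these chain sums in depth `k + 1`. In the variable `y = tan (a / 2)` the parity
condition becomes `dF_{k+1}/da = F_k` and `dF_0/da = 1 / cos a` (`hasDerivAt_chainGen_succ`,
`hasDerivAt_chainGen_zero`), and the division by the largest index becomes integration against
`da / sin a` (`hasDerivAt_outerGen`), so that
`T = (-1)^m ∫_0^{π/2} F_{2m}(tan (a / 2)) / sin a da`.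

On the other hand `1 / cos a` is formally `2 ∑ (-1)^n cos ((2n+1) a)`. Truncating this series
leaves an oscillating error that is `O(1/M)` after one integration, so the series may be integrated
termwise from `0`. Thus `F_{2m}` is, up to sign, twice
`∑ (-1)^n sin ((2n+1) a) / (2n+1)^{2m+1}` minus twice its Taylor polynomial at `0` of degree
`2m - 1`, whose coefficients are the beta values at even integers (`chainGen_two_mul`).

Integrate this against `da / sin a`. Since `∫_0^{π/2} sin ((2n+1) a) / sin a da = π / 2`, the series
gives `π β(2m+1)`. The moments `∫_0^{π/2} a^{2i+1} / sin a da` are evaluated with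
`2 ∑_{n<K} sin ((2n+1) a) = (1 - cos (2Ka)) / sin a`, the Riemann-Lebesgue lemma and integration by
parts (`integral_pow_div_sin`). The result, `mtv_eq_beta_even`, contains the products
`β(r+1) β(p+1)` with `r`, `p` odd. The products with `r`, `p` even add up to `π β(2m+1)`, because
`cos (π x / 2) ∑ β(2k+1) x^{2k} = π / 4`; this follows in the same way from
`2 ∑_{n<K} cos ((2n+1) a) = sin (2Ka) / sin a` (`sum_dirichletBeta_odd`), and it also shows that
`β(2k+1)` is a rational multiple of `π^{2k+1}`, which gives the two memberships.
-/

/-! ### Sums over decreasing chains -/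

open Classical in
/-- The decreasing chains `N > f 0 > f 1 > ⋯ > f (r - 1) > 0`. -/
noncomputable def decreasingChains (r N : ℕ) : Finset (Fin r → ℕ) :=
  {f ∈ Fintype.piFinset fun _ : Fin r => Finset.Ico 1 N | StrictAnti f}

theorem mem_decreasingChains {r N : ℕ} {f : Fin r → ℕ} :
    f ∈ decreasingChains r N ↔ (∀ i, 1 ≤ f i ∧ f i < N) ∧ StrictAnti f := by
  simp [decreasingChains, Fintype.mem_piFinset]

theorem sum_decreasingChains_zero (N : ℕ) (w : Fin 0 → ℕ → ℝ) :
    ∑ f ∈ decreasingChains 0 N, ∏ i, w i (f i) = 1 := by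
  have : decreasingChains 0 N = {Fin.elim0} := by
    ext f
    simp only [mem_decreasingChains, Finset.mem_singleton]
    exact ⟨fun _ => Subsingleton.elim _ _, fun _ => ⟨fun i => i.elim0, fun i => i.elim0⟩⟩
  simp [this]

/-- Sums of products over decreasing chains are computed by splitting off the largest entry. -/
theorem sum_decreasingChains_succ (r N : ℕ) (w : Fin (r + 1) → ℕ → ℝ) :
    ∑ f ∈ decreasingChains (r + 1) N, ∏ i, w i (f i) =
      ∑ n ∈ Finset.Ico 1 N, w 0 n * ∑ g ∈ decreasingChains r n, ∏ i, w i.succ (g i) := by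
  simp_rw [Finset.mul_sum]
  rw [Finset.sum_sigma']
  refine Finset.sum_bij' (fun f _ => (⟨f 0, Fin.tail f⟩ : (_ : ℕ) × (Fin r → ℕ)))
    (fun p _ => Fin.cons p.1 p.2) ?_ ?_ ?_ ?_ ?_
  · intro f hf
    rw [mem_decreasingChains] at hf
    simp only [Finset.mem_sigma, Finset.mem_Ico, mem_decreasingChains]
    refine ⟨hf.1 0, fun i => ⟨(hf.1 i.succ).1, hf.2 (Fin.succ_pos i)⟩, ?_⟩
    intro i j hij
    exact hf.2 (Fin.succ_lt_succ_iff.mpr hij)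
  · rintro ⟨n, g⟩ hp
    simp only [Finset.mem_sigma, Finset.mem_Ico, mem_decreasingChains] at hp
    obtain ⟨hn, hg, hanti⟩ := hp
    rw [mem_decreasingChains]
    refine ⟨fun i => ?_, ?_⟩
    · refine Fin.cases ?_ (fun i => ?_) i
      · simpa using hn
      · simpa using ⟨(hg i).1, (hg i).2.trans hn.2⟩
    · intro i j
      refine Fin.cases ?_ (fun i => ?_) i <;> refine Fin.cases ?_ (fun j => ?_) j
      · simp
      · intro _
        simpa using (hg j).2
      · intro h
        exact absurd h (Fin.not_lt_zero _)
      · intro h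
        simpa using hanti (Fin.succ_lt_succ_iff.mp h)
  · intro f _
    exact Fin.cons_self_tail f
  · rintro ⟨n, g⟩ _
    simp
  · intro f _
    rw [Fin.prod_univ_succ]
    rfl

/-- The sum of `2 ^ (k + 1) * (-1) ^ ((n_k + 1) / 2) / (n₀ ⋯ n_k)` over all chains
`n = n₀ > n₁ > ⋯ > n_k > 0` of alternating parities with `n_k` odd, defined by recursion on the
depth. The factors `1 ± (-1) ^ n` select the parity of `n` and account for the powers of `2`. -/
noncomputable def altChainSum : ℕ → ℕ → ℝ
  | 0, n => (1 - (-1) ^ n) / n * (-1) ^ ((n + 1) / 2)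
  | k + 1, n => (1 + (-1) ^ (k + n)) / n * ∑ j ∈ Finset.Ico 1 n, altChainSum k j

/-- The recursive definition of `altChainSum` agrees with sums over decreasing chains. -/
theorem sum_decreasingChains_eq_altChainSum (k N : ℕ) (w : Fin (k + 1) → ℕ → ℝ)
    (hw : ∀ i : Fin (k + 1), i ≠ Fin.last k → ∀ n,
      w i n = (1 + (-1) ^ (k + 1 - (i : ℕ)) * (-1) ^ n) / n)
    (hlast : ∀ n, w (Fin.last k) n = (1 - (-1) ^ n) / n * (-1) ^ ((n + 1) / 2)) :
    ∑ f ∈ decreasingChains (k + 1) N, ∏ i, w i (f i) =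
      ∑ n ∈ Finset.Ico 1 N, altChainSum k n := by
  induction k generalizing N with
  | zero =>
    rw [sum_decreasingChains_succ]
    refine Finset.sum_congr rfl fun n _ => ?_
    rw [sum_decreasingChains_zero n (fun i => w i.succ), altChainSum, mul_one]
    exact hlast n
  | succ k ih =>
    rw [sum_decreasingChains_succ]
    refine Finset.sum_congr rfl fun n _ => ?_
    rw [ih n (fun i => w i.succ), altChainSum, hw 0]
    · simp only [Fin.val_zero, Nat.sub_zero]
      congr 2
      ring
    · simp [Fin.ext_iff]
    · intro i hi n
      rw [hw]
      · simp
      · rw [← Fin.succ_last]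
        exact fun h => hi (Fin.succ_injective _ h)
    · intro n
      rw [Fin.succ_last]
      exact hlast n

/-- Twice the harmonic sum `∑_{1 ≤ j < n} 1 / j`. -/
noncomputable def twiceHarmonic (n : ℕ) : ℝ := ∑ j ∈ Finset.Ico 1 n, 2 / (j : ℝ)

theorem twiceHarmonic_nonneg (n : ℕ) : 0 ≤ twiceHarmonic n :=
  Finset.sum_nonneg fun _ _ => by positivity

theorem twiceHarmonic_mono {a b : ℕ} (h : a ≤ b) : twiceHarmonic a ≤ twiceHarmonic b :=
  Finset.sum_le_sum_of_subset_of_nonneg (Finset.Ico_subset_Ico le_rfl h)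
    fun _ _ _ => by positivity

theorem twiceHarmonic_le (n : ℕ) : twiceHarmonic n ≤ 2 * n := by
  calc twiceHarmonic n ≤ ∑ j ∈ Finset.Ico 1 n, (2 : ℝ) := by
        refine Finset.sum_le_sum fun j hj => ?_
        have : (1 : ℝ) ≤ j := by exact_mod_cast (Finset.mem_Ico.mp hj).1
        exact div_le_self (by norm_num) this
    _ ≤ 2 * n := by
        rw [Finset.sum_const, Nat.card_Ico, nsmul_eq_mul, mul_comm]
        gcongr
        exact Nat.sub_le n 1

theorem twiceHarmonic_le_log (n : ℕ) : twiceHarmonic n ≤ 2 * (1 + Real.log n) := by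
  have h1 : twiceHarmonic n ≤ 2 * (harmonic n : ℝ) := by
    rw [twiceHarmonic, harmonic_eq_sum_Icc]
    push_cast
    rw [Finset.mul_sum]
    simp_rw [div_eq_mul_inv]
    exact Finset.sum_le_sum_of_subset_of_nonneg
      (fun x hx => by simp at hx ⊢; omega) fun _ _ _ => by positivity
  exact h1.trans (by gcongr; exact harmonic_le_one_add_log n)

/-- A power of the harmonic sum is `O(√n)`, so it does not spoil the convergence of
`∑ 1 / n ^ 2`. -/
theorem summable_twiceHarmonic_pow_div_sq (p : ℕ) :
    Summable fun n : ℕ => twiceHarmonic n ^ p / (n : ℝ) ^ 2 := by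
  have h1 : (fun x : ℝ => (1 + Real.log x) ^ p) =o[atTop] fun x : ℝ => x ^ (1 / 2 : ℝ) := by
    have hl : (fun x : ℝ => 1 + Real.log x) =O[atTop] Real.log :=
      (((Real.isLittleO_const_log_atTop (c := (1 : ℝ))).add_isBigO
        (Asymptotics.isBigO_refl Real.log atTop)))
    have := isLittleO_log_rpow_rpow_atTop (s := 1 / 2) (p : ℝ) (by norm_num)
    simp only [Real.rpow_natCast] at this
    exact (hl.pow p).trans_isLittleO this
  have h2 := (h1.comp_tendsto tendsto_natCast_atTop_atTop).isBigO
  have hs : Summable fun n : ℕ => ((n : ℝ) ^ (3 / 2 : ℝ))⁻¹ :=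
    Real.summable_nat_rpow_inv.mpr (by norm_num)
  refine summable_of_isBigO_nat hs ?_
  have h3 : (fun n : ℕ => twiceHarmonic n ^ p) =O[atTop] fun n : ℕ => (n : ℝ) ^ (1 / 2 : ℝ) := by
    refine Asymptotics.IsBigO.trans (Asymptotics.IsBigO.of_bound (2 ^ p) ?_) h2
    refine Eventually.of_forall fun n => ?_
    have h0 := twiceHarmonic_nonneg n
    have hle := twiceHarmonic_le_log n
    rw [Real.norm_of_nonneg (pow_nonneg h0 p), Function.comp_apply, Real.norm_of_nonneg
      (pow_nonneg (by linarith) p), ← mul_pow]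
    exact pow_le_pow_left₀ h0 hle p
  have h4 := h3.mul (Asymptotics.isBigO_refl (fun n : ℕ => ((n : ℝ) ^ 2)⁻¹) atTop)
  refine (h4.congr_left fun n => (div_eq_mul_inv _ _).symm).congr' EventuallyEq.rfl ?_
  filter_upwards [eventually_gt_atTop 0] with n hn
  have hn' : (0 : ℝ) < n := by exact_mod_cast hn
  rw [← Real.rpow_natCast, ← Real.rpow_neg hn'.le, ← Real.rpow_neg hn'.le, ← Real.rpow_add hn']
  norm_num

theorem abs_one_add_pow_mul_le (a b : ℕ) : |1 + (-1 : ℝ) ^ a * (-1) ^ b| ≤ 2 := by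
  rw [← pow_add]
  rcases neg_one_pow_eq_or ℝ (a + b) with h | h <;> rw [h] <;> norm_num

theorem abs_altChainSum_le (k n : ℕ) :
    |altChainSum k n| ≤ 2 / n * twiceHarmonic n ^ k := by
  induction k generalizing n with
  | zero =>
    rw [altChainSum, abs_mul, abs_div, abs_pow, abs_neg, abs_one, one_pow, pow_zero,
      Nat.abs_cast]
    gcongr
    simpa [← sub_eq_add_neg] using abs_one_add_pow_mul_le 1 n
  | succ k ih =>
    rw [altChainSum, abs_mul, abs_div, Nat.abs_cast]
    gcongr
    · simpa [pow_add] using abs_one_add_pow_mul_le k n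
    · calc |∑ j ∈ Finset.Ico 1 n, altChainSum k j|
          ≤ ∑ j ∈ Finset.Ico 1 n, |altChainSum k j| := Finset.abs_sum_le_sum_abs _ _
        _ ≤ ∑ j ∈ Finset.Ico 1 n, 2 / (j : ℝ) * twiceHarmonic n ^ k := by
          refine Finset.sum_le_sum fun j hj => (ih j).trans ?_
          have := twiceHarmonic_mono (Finset.mem_Ico.mp hj).2.le
          have := twiceHarmonic_nonneg j
          gcongr
        _ = twiceHarmonic n ^ (k + 1) := by
          rw [← Finset.sum_mul, pow_succ', twiceHarmonic]

/-- Forgetting that chains decrease bounds a sum over chains by a power of a harmonic sum. -/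
theorem sum_decreasingChains_prod_le (r N : ℕ) (w : Fin r → ℕ → ℝ) (h0 : ∀ i n, 0 ≤ w i n)
    (hw : ∀ i n, w i n ≤ 2 / n) :
    ∑ f ∈ decreasingChains r N, ∏ i, w i (f i) ≤ twiceHarmonic N ^ r := by
  classical
  calc ∑ f ∈ decreasingChains r N, ∏ i, w i (f i)
      ≤ ∑ f ∈ Fintype.piFinset fun _ : Fin r => Finset.Ico 1 N, ∏ i, w i (f i) := by
        refine Finset.sum_le_sum_of_subset_of_nonneg (fun f hf => ?_)
          fun f _ _ => Finset.prod_nonneg fun i _ => h0 i _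
        rw [mem_decreasingChains] at hf
        simpa [Fintype.mem_piFinset] using hf.1
    _ ≤ ∑ f ∈ Fintype.piFinset fun _ : Fin r => Finset.Ico 1 N, ∏ i, 2 / (f i : ℝ) :=
        Finset.sum_le_sum fun f _ => Finset.prod_le_prod (fun i _ => h0 i _) fun i _ => hw i _
    _ = twiceHarmonic N ^ r := by
        rw [← Finset.prod_univ_sum (fun _ => Finset.Ico 1 N) fun _ j => 2 / (j : ℝ)]
        simp [twiceHarmonic]

/-! ### Generating functions of chain sums -/

/-- Termwise differentiation of a power series whose coefficients grow polynomially. -/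
theorem hasDerivAt_tsum_mul_pow {a : ℕ → ℝ} {K : ℝ} {p : ℕ} (ha : ∀ n, |a n| ≤ K * (n + 1) ^ p)
    {y : ℝ} (hy : |y| < 1) :
    HasDerivAt (fun z => ∑' n, a n * z ^ n) (∑' n : ℕ, (n + 1) * a (n + 1) * y ^ n) y ∧
      Summable fun n : ℕ => (n + 1) * a (n + 1) * y ^ n := by
  have hK : 0 ≤ K := by simpa using (abs_nonneg _).trans (ha 0)
  obtain ⟨ρ, hyρ, hρ⟩ := exists_between hy
  have hρ0 : 0 < ρ := (abs_nonneg y).trans_lt hyρ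
  have hgeom : Summable fun n : ℕ => ((n : ℝ) + 1) ^ (p + 1) * ρ ^ (n + 1) := by
    have := (summable_nat_add_iff 1).mpr (summable_pow_mul_geometric_of_norm_lt_one (R := ℝ) (p + 1)
      (r := ρ) (by rwa [Real.norm_of_nonneg hρ0.le]))
    simpa using this
  have hu := hgeom.mul_left (K / ρ ^ 2)
  have hbound : ∀ (n : ℕ) (z : ℝ), z ∈ Metric.ball (0 : ℝ) ρ →
      ‖a n * (n * z ^ (n - 1))‖ ≤ K / ρ ^ 2 * (((n : ℝ) + 1) ^ (p + 1) * ρ ^ (n + 1)) := by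
    intro n z hz
    rw [mem_ball_zero_iff, Real.norm_eq_abs] at hz
    rcases n with _ | n
    · simp only [Nat.cast_zero, zero_mul, mul_zero, norm_zero]
      positivity
    · have hzn : |z| ^ n ≤ ρ ^ n := pow_le_pow_left₀ (abs_nonneg z) hz.le n
      have hn : ((n + 1 : ℕ) : ℝ) ≤ ((n + 1 : ℕ) : ℝ) + 1 := by linarith
      calc ‖a (n + 1) * ((n + 1 : ℕ) * z ^ (n + 1 - 1))‖
          = |a (n + 1)| * (((n + 1 : ℕ) : ℝ) * |z| ^ n) := by
            rw [Real.norm_eq_abs, abs_mul, abs_mul, abs_pow, Nat.abs_cast, Nat.add_sub_cancel]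
        _ ≤ (K * (((n + 1 : ℕ) : ℝ) + 1) ^ p) * ((((n + 1 : ℕ) : ℝ) + 1) * ρ ^ n) := by
            gcongr
            exact ha (n + 1)
        _ = _ := by field_simp; ring
  have hy' : y ∈ Metric.ball (0 : ℝ) ρ := by simpa using hyρ
  have h0 : Summable fun n => a n * (0 : ℝ) ^ n :=
    summable_of_ne_finset_zero (s := {0}) fun n hn => by
      rw [zero_pow (by simpa using hn), mul_zero]
  have hd := hasDerivAt_tsum_of_isPreconnected (g := fun n z => a n * z ^ n)
    (g' := fun n z => a n * (n * z ^ (n - 1))) hu Metric.isOpen_ball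
    (convex_ball (0 : ℝ) ρ).isPreconnected
    (fun n z _ => (hasDerivAt_pow n z).const_mul (a n)) hbound (Metric.mem_ball_self hρ0) h0 hy'
  have hs : Summable fun n : ℕ => a n * (n * y ^ (n - 1)) :=
    Summable.of_norm_bounded hu fun n => hbound n y hy'
  have hs' := (summable_nat_add_iff 1).mpr hs
  have hfun : (fun n : ℕ => a (n + 1) * ((n + 1 : ℕ) * y ^ (n + 1 - 1))) =
      fun n : ℕ => (n + 1) * a (n + 1) * y ^ n := by
    funext n
    push_cast
    ring
  rw [hfun] at hs'
  refine ⟨?_, hs'⟩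
  rw [hs.tsum_eq_zero_add, hfun] at hd
  simpa using hd

theorem altChainSum_zero_right (k : ℕ) : altChainSum k 0 = 0 := by
  cases k <;> simp [altChainSum]

theorem altChainSum_eq_zero_of_even {k n : ℕ} (h : Even (k + n)) : altChainSum k n = 0 := by
  cases k with
  | zero =>
    rw [zero_add] at h
    simp [altChainSum, h.neg_one_pow]
  | succ k =>
    have : Odd (k + n) := by
      rw [add_right_comm] at h
      exact Nat.not_even_iff_odd.mp (Nat.even_add_one.mp h)
    simp [altChainSum, this.neg_one_pow]

/-- The coefficients `altChainSum k n` with signs that turn their generating functions `F_k` in `y`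
into solutions of `(1 + y ^ 2) F_{k+1}' = 2 F_k`; without these signs, the factor would be
`1 - y ^ 2`. The division in the exponent is exact unless
`altChainSum k n` vanishes. -/
noncomputable def signedChainSum (k n : ℕ) : ℝ :=
  (-1) ^ ((n + 1 + 3 * k) / 2) * altChainSum k n

theorem signedChainSum_zero_left (n : ℕ) : signedChainSum 0 n = (1 - (-1) ^ n) / n := by
  rw [signedChainSum, altChainSum, mul_zero, add_zero, mul_left_comm, ← pow_add, ← two_mul,
    pow_mul, neg_one_sq, one_pow, mul_one]

theorem signedChainSum_zero_right (k : ℕ) : signedChainSum k 0 = 0 := by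
  rw [signedChainSum, altChainSum_zero_right, mul_zero]

theorem abs_signedChainSum (k n : ℕ) : |signedChainSum k n| = |altChainSum k n| := by
  rw [signedChainSum, abs_mul, abs_pow, abs_neg, abs_one, one_pow, one_mul]

theorem abs_signedChainSum_le (k n : ℕ) :
    |signedChainSum k n| ≤ 2 * 2 ^ k * ((n : ℝ) + 1) ^ k := by
  rw [abs_signedChainSum]
  have h2 : twiceHarmonic n ≤ 2 * ((n : ℝ) + 1) := (twiceHarmonic_le n).trans (by linarith)
  calc |altChainSum k n| ≤ 2 / n * twiceHarmonic n ^ k := abs_altChainSum_le k n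
    _ ≤ 2 * (2 * ((n : ℝ) + 1)) ^ k := by
        have h3 : (2 : ℝ) / n ≤ 2 := by
          rcases Nat.eq_zero_or_pos n with rfl | hn
          · simp
          · exact div_le_self (by norm_num) (by exact_mod_cast hn)
        have := twiceHarmonic_nonneg n
        gcongr
    _ = _ := by rw [mul_pow]; ring

theorem signedChainSum_one_right (k : ℕ) : signedChainSum (k + 1) 1 = 0 := by
  rw [signedChainSum, altChainSum, Finset.Ico_self, Finset.sum_empty, mul_zero, mul_zero]

/-- The coefficient form of the differential equation `(1 + y ^ 2) F_{k+1}' = 2 F_k`. -/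
theorem signedChainSum_rec (k n : ℕ) :
    (n + 2) * signedChainSum (k + 1) (n + 2) + n * signedChainSum (k + 1) n =
      2 * signedChainSum k (n + 1) := by
  rcases Nat.even_or_odd (k + n) with h | h
  · have e1 : (n + 2 + 1 + 3 * (k + 1)) / 2 = (n + 1 + 1 + 3 * k) / 2 + 2 := by omega
    have e2 : (n + 1 + 3 * (k + 1)) / 2 = (n + 1 + 1 + 3 * k) / 2 + 1 := by omega
    have hIco : ∀ N, ∑ j ∈ Finset.Ico 1 N, altChainSum k j =
        ∑ j ∈ Finset.range N, altChainSum k j := by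
      intro N
      refine Finset.sum_subset (fun j hj => by simp at hj ⊢; omega) fun j hj hj' => ?_
      have : j = 0 := by simp at hj hj'; omega
      rw [this, altChainSum_zero_right]
    rw [signedChainSum, signedChainSum, signedChainSum, e1, e2, altChainSum, altChainSum, hIco,
      hIco, Finset.sum_range_succ, Finset.sum_range_succ, altChainSum_eq_zero_of_even h,
      ← add_assoc k n 2,
      pow_add _ (k + n) 2, h.neg_one_pow]
    rcases Nat.eq_zero_or_pos n with rfl | hn
    · simp [pow_succ]
    · have hn' : (n : ℝ) ≠ 0 := by positivity
      push_cast
      rw [pow_add _ _ 2, pow_succ]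
      field_simp
      ring
  · have h1 : Even (k + 1 + n) := by rw [add_right_comm]; exact h.add_one
    have h2 : Even (k + 1 + (n + 2)) := by rw [← add_assoc]; exact h1.add even_two
    have h3 : Even (k + (n + 1)) := h.add_one
    simp [signedChainSum, altChainSum_eq_zero_of_even h1, altChainSum_eq_zero_of_even h2,
      altChainSum_eq_zero_of_even h3]

/-- The generating function of the signed chain sums, in the angular variable
`y = tan (a / 2)`. -/
noncomputable def chainGen (k : ℕ) (a : ℝ) : ℝ := ∑' n, signedChainSum k n * Real.tan (a / 2) ^ n

theorem chainGen_zero_right (k : ℕ) : chainGen k 0 = 0 := by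
  rw [chainGen, zero_div, Real.tan_zero]
  convert tsum_zero with n
  rcases n with _ | n
  · rw [signedChainSum_zero_right, zero_mul]
  · rw [zero_pow n.succ_ne_zero, mul_zero]

theorem cos_half_pos {a : ℝ} (ha : |a| < Real.pi / 2) : 0 < Real.cos (a / 2) := by
  rw [abs_lt] at ha
  exact Real.cos_pos_of_mem_Ioo ⟨by linarith [Real.pi_pos], by linarith [Real.pi_pos]⟩

theorem hasDerivAt_tan_half {a : ℝ} (ha : |a| < Real.pi / 2) :
    HasDerivAt (fun a => Real.tan (a / 2)) ((1 + Real.tan (a / 2) ^ 2) / 2) a := by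
  have h := (cos_half_pos ha).ne'
  have := (Real.hasDerivAt_tan h).comp a ((hasDerivAt_id a).div_const 2)
  convert! this using 1
  rw [Real.tan_eq_sin_div_cos]
  field_simp
  rw [Real.cos_sq_add_sin_sq]

theorem abs_tan_half_lt_one {a : ℝ} (ha : |a| < Real.pi / 2) : |Real.tan (a / 2)| < 1 := by
  have hp := Real.pi_pos
  rw [abs_lt] at ha ⊢
  rw [← Real.tan_pi_div_four, ← Real.tan_neg]
  exact ⟨Real.tan_lt_tan_of_lt_of_lt_pi_div_two (by linarith) (by linarith) (by linarith),
    Real.tan_lt_tan_of_lt_of_lt_pi_div_two (by linarith) (by linarith) (by linarith)⟩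

theorem summable_signedChainSum_mul_pow (k : ℕ) {y : ℝ} (hy : |y| < 1) :
    Summable fun n => signedChainSum k n * y ^ n := by
  refine Summable.of_norm_bounded (g := fun n : ℕ =>
    2 * 2 ^ k / |y| * (((n : ℝ) + 1) ^ k * |y| ^ (n + 1))) (Summable.mul_left _ ?_) fun n => ?_
  · have := (summable_nat_add_iff 1).mpr (summable_pow_mul_geometric_of_norm_lt_one (R := ℝ) k
      (r := |y|) (by rwa [Real.norm_of_nonneg (abs_nonneg y)]))
    simpa using this
  · rw [Real.norm_eq_abs, abs_mul, abs_pow]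
    rcases eq_or_ne y 0 with rfl | h0
    · rcases n with _ | n
      · simp [signedChainSum_zero_right]
      · simp
    · have h0' := abs_pos.mpr h0
      calc |signedChainSum k n| * |y| ^ n ≤ 2 * 2 ^ k * ((n : ℝ) + 1) ^ k * |y| ^ n := by
            gcongr
            exact abs_signedChainSum_le k n
        _ = _ := by field_simp; ring

/-- With `y = tan (a / 2)`, the generating function in depth one is the integral of `1 / cos`. -/
theorem hasDerivAt_chainGen_zero {a : ℝ} (ha : |a| < Real.pi / 2) :
    HasDerivAt (chainGen 0) (1 / Real.cos a) a := by
  have hy := abs_tan_half_lt_one ha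
  have hd := (hasDerivAt_tsum_mul_pow (abs_signedChainSum_le 0) hy).1
  have hc := hd.comp a (hasDerivAt_tan_half ha)
  convert! hc using 1
  have hcos : 0 < Real.cos a := Real.cos_pos_of_mem_Ioo ⟨(abs_lt.mp ha).1, (abs_lt.mp ha).2⟩
  rw [Real.cos_eq_two_mul_tan_half_div_one_sub_tan_half_sq a (by linarith)]
  set y := Real.tan (a / 2)
  have h1 := hasSum_geometric_of_abs_lt_one hy
  have h2 := hasSum_geometric_of_abs_lt_one (r := -y) (by rwa [abs_neg])
  have h3 : ∑' n : ℕ, ((n : ℝ) + 1) * signedChainSum 0 (n + 1) * y ^ n =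
      (1 - y)⁻¹ + (1 - -y)⁻¹ := by
    rw [← (h1.add h2).tsum_eq]
    refine tsum_congr fun n => ?_
    rw [signedChainSum_zero_left, neg_pow y, pow_succ]
    have : (n : ℝ) + 1 ≠ 0 := by positivity
    push_cast
    field_simp
    ring
  rw [h3]
  rw [abs_lt] at hy
  have e1 : 1 - y ≠ 0 := by linarith
  have e2 : 1 + y ≠ 0 := by linarith
  have e3 : 1 - y ^ 2 ≠ 0 := by
    rw [← one_pow 2, sq_sub_sq]
    exact mul_ne_zero e2 e1
  rw [sub_neg_eq_add]
  field_simp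
  ring

/-- With `y = tan (a / 2)`, the generating function in depth `k + 2` is the integral of the one in
depth `k + 1`. -/
theorem hasDerivAt_chainGen_succ (k : ℕ) {a : ℝ} (ha : |a| < Real.pi / 2) :
    HasDerivAt (chainGen (k + 1)) (chainGen k a) a := by
  have hy := abs_tan_half_lt_one ha
  obtain ⟨hd, hs⟩ := hasDerivAt_tsum_mul_pow (abs_signedChainSum_le (k + 1)) hy
  have hc := hd.comp a (hasDerivAt_tan_half ha)
  convert! hc using 1
  rw [chainGen]
  set y := Real.tan (a / 2)
  have hF := summable_signedChainSum_mul_pow k hy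
  have hs2 := hs.mul_right (y ^ 2)
  have key : 2 * ∑' n, signedChainSum k n * y ^ n =
      ∑' n : ℕ, ((n : ℝ) + 1) * signedChainSum (k + 1) (n + 1) * y ^ n +
      (∑' n : ℕ, ((n : ℝ) + 1) * signedChainSum (k + 1) (n + 1) * y ^ n) * y ^ 2 := by
    rw [← hF.sum_add_tsum_nat_add 2]
    rw [← tsum_mul_right, ← hs.sum_add_tsum_nat_add 2, add_assoc,
      ← ((summable_nat_add_iff 2).mpr hs).tsum_add hs2, mul_add, ← tsum_mul_left]
    congr 1
    · have h := signedChainSum_rec k 0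
      simp only [Finset.sum_range_succ, Finset.sum_range_zero, signedChainSum_zero_right]
      push_cast at h ⊢
      simp only [zero_add, zero_mul, add_zero, one_add_one_eq_two,
        signedChainSum_one_right] at h ⊢
      linear_combination -y ^ 1 * h
    · refine tsum_congr fun n => ?_
      have h := signedChainSum_rec k (n + 1)
      push_cast at h ⊢
      linear_combination (-y ^ (n + 2)) * h
  linear_combination key / 2

/-! ### Trigonometric moments and the Riemann-Lebesgue lemma -/

theorem two_mul_add_one_pos (n : ℕ) : (0 : ℝ) < 2 * (n : ℝ) + 1 := by positivity

theorem sin_odd_mul_pi_div_two (n : ℕ) :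
    Real.sin ((2 * (n : ℝ) + 1) * (Real.pi / 2)) = (-1) ^ n := by
  have : (2 * (n : ℝ) + 1) * (Real.pi / 2) = Real.pi / 2 + n * Real.pi := by ring
  rw [this, Real.sin_add_nat_mul_pi, Real.sin_pi_div_two, mul_one]

theorem cos_odd_mul_pi_div_two (n : ℕ) : Real.cos ((2 * (n : ℝ) + 1) * (Real.pi / 2)) = 0 := by
  have : (2 * (n : ℝ) + 1) * (Real.pi / 2) = Real.pi / 2 + n * Real.pi := by ring
  rw [this, Real.cos_add_nat_mul_pi, Real.cos_pi_div_two, mul_zero]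

theorem hasDerivAt_cos_mul (c a : ℝ) :
    HasDerivAt (fun x => Real.cos (c * x)) (-(c * Real.sin (c * a))) a := by
  have := (Real.hasDerivAt_cos (c * a)).comp a ((hasDerivAt_id a).const_mul c)
  convert! this using 1
  ring

theorem hasDerivAt_sin_mul (c a : ℝ) :
    HasDerivAt (fun x => Real.sin (c * x)) (c * Real.cos (c * a)) a := by
  have := (Real.hasDerivAt_sin (c * a)).comp a ((hasDerivAt_id a).const_mul c)
  convert! this using 1
  ring

theorem hasDerivAt_pow_div_factorial (p : ℕ) (a : ℝ) :
    HasDerivAt (fun x : ℝ => x ^ (p + 1) / (p + 1).factorial) (a ^ p / p.factorial) a := by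
  have := (hasDerivAt_pow (p + 1) a).div_const ((p + 1).factorial : ℝ)
  convert! this using 1
  rw [Nat.factorial_succ]
  have : (p.factorial : ℝ) ≠ 0 := by positivity
  push_cast
  field_simp

/-- The moment `∫_0^{π/2} a ^ p / p! * cos (N a) da` with `N = 2 n + 1`. -/
noncomputable def cosMoment (p n : ℕ) : ℝ :=
  ∫ a in (0 : ℝ)..Real.pi / 2, a ^ p / p.factorial * Real.cos ((2 * (n : ℝ) + 1) * a)

/-- The moment `∫_0^{π/2} a ^ p / p! * sin (N a) da` with `N = 2 n + 1`. -/
noncomputable def sinMoment (p n : ℕ) : ℝ :=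
  ∫ a in (0 : ℝ)..Real.pi / 2, a ^ p / p.factorial * Real.sin ((2 * (n : ℝ) + 1) * a)

theorem sinMoment_succ (p n : ℕ) : sinMoment (p + 1) n = cosMoment p n / (2 * (n : ℝ) + 1) := by
  have hN := (two_mul_add_one_pos n).ne'
  have h := intervalIntegral.integral_eq_sub_of_hasDerivAt (a := 0) (b := Real.pi / 2)
    (f := fun a : ℝ => a ^ (p + 1) / (p + 1).factorial * Real.cos ((2 * (n : ℝ) + 1) * a))
    (fun a _ => (hasDerivAt_pow_div_factorial p a).mul (hasDerivAt_cos_mul (2 * (n : ℝ) + 1) a))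
    (Continuous.intervalIntegrable (by fun_prop) _ _)
  rw [intervalIntegral.integral_add (Continuous.intervalIntegrable (by fun_prop) _ _)
    (Continuous.intervalIntegrable (by fun_prop) _ _), cos_odd_mul_pi_div_two] at h
  simp_rw [mul_neg, mul_left_comm _ (2 * (n : ℝ) + 1)] at h
  rw [intervalIntegral.integral_neg, intervalIntegral.integral_const_mul, ← cosMoment, ← sinMoment,
    zero_pow p.succ_ne_zero] at h
  rw [eq_div_iff hN]
  linear_combination -h

theorem cosMoment_succ (p n : ℕ) : cosMoment (p + 1) n =
    ((Real.pi / 2) ^ (p + 1) / (p + 1).factorial * (-1) ^ n - sinMoment p n) /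
      (2 * (n : ℝ) + 1) := by
  have hN := (two_mul_add_one_pos n).ne'
  have h := intervalIntegral.integral_eq_sub_of_hasDerivAt (a := 0) (b := Real.pi / 2)
    (f := fun a : ℝ => a ^ (p + 1) / (p + 1).factorial * Real.sin ((2 * (n : ℝ) + 1) * a))
    (fun a _ => (hasDerivAt_pow_div_factorial p a).mul (hasDerivAt_sin_mul (2 * (n : ℝ) + 1) a))
    (Continuous.intervalIntegrable (by fun_prop) _ _)
  rw [intervalIntegral.integral_add (Continuous.intervalIntegrable (by fun_prop) _ _)
    (Continuous.intervalIntegrable (by fun_prop) _ _), sin_odd_mul_pi_div_two] at h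
  simp_rw [mul_left_comm _ (2 * (n : ℝ) + 1)] at h
  rw [intervalIntegral.integral_const_mul, ← cosMoment, ← sinMoment,
    zero_pow p.succ_ne_zero] at h
  rw [eq_div_iff hN]
  linear_combination h

theorem cosMoment_zero (n : ℕ) : cosMoment 0 n = (-1) ^ n / (2 * (n : ℝ) + 1) := by
  have hN := (two_mul_add_one_pos n).ne'
  have h := intervalIntegral.integral_eq_sub_of_hasDerivAt (a := 0) (b := Real.pi / 2)
    (f := fun a : ℝ => Real.sin ((2 * (n : ℝ) + 1) * a))
    (fun a _ => hasDerivAt_sin_mul (2 * (n : ℝ) + 1) a)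
    (Continuous.intervalIntegrable (by fun_prop) _ _)
  rw [intervalIntegral.integral_const_mul, sin_odd_mul_pi_div_two] at h
  rw [eq_div_iff hN, cosMoment]
  simp only [mul_zero, Real.sin_zero, sub_zero] at h
  simp only [pow_zero, Nat.factorial_zero, Nat.cast_one, div_one, one_mul]
  linear_combination h

/-- The even cosine moments, by repeated integration by parts: no boundary terms occur at `0`, and
at `π / 2` only the sines contribute. -/
theorem cosMoment_two_mul (M n : ℕ) : cosMoment (2 * M) n =
    ∑ k ∈ Finset.range (M + 1), (-1) ^ (M - k) * ((Real.pi / 2) ^ (2 * k) / (2 * k).factorial) *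
      ((-1) ^ n / (2 * (n : ℝ) + 1) ^ (2 * (M - k) + 1)) := by
  have hN := (two_mul_add_one_pos n).ne'
  induction M with
  | zero => simp [cosMoment_zero]
  | succ M ih =>
    rw [Finset.sum_range_succ, show 2 * (M + 1) = 2 * M + 1 + 1 by ring, cosMoment_succ,
      sinMoment_succ, ih, sub_div, sub_eq_neg_add, Nat.sub_self]
    congr 1
    · rw [div_div, Finset.sum_div, ← Finset.sum_neg_distrib]
      refine Finset.sum_congr rfl fun k hk => ?_
      have hk' : M + 1 - k = (M - k) + 1 := by
        have := Finset.mem_range.mp hk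
        omega
      rw [hk', mul_add 2, pow_succ _ (M - k)]
      field_simp
      ring
    · simp
      ring

/-- The Riemann-Lebesgue lemma on `[0, π / 2]`, along the even integers. -/
theorem tendsto_integral_mul_cos_sin {f : ℝ → ℝ}
    (hf : IntervalIntegrable f MeasureTheory.volume 0 (Real.pi / 2)) :
    Tendsto (fun M : ℕ => ∫ a in (0 : ℝ)..Real.pi / 2, f a * Real.cos (2 * (M : ℝ) * a))
      atTop (𝓝 0) ∧
    Tendsto (fun M : ℕ => ∫ a in (0 : ℝ)..Real.pi / 2, f a * Real.sin (2 * (M : ℝ) * a))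
      atTop (𝓝 0) := by
  have hp : (0 : ℝ) ≤ Real.pi / 2 := by positivity
  -- the frequency `M / π` turns the Fourier character into `exp (-2 M a i)`
  have hw : Tendsto (fun M : ℕ => (M : ℝ) / Real.pi) atTop (cocompact ℝ) :=
    (tendsto_natCast_atTop_atTop.atTop_div_const Real.pi_pos).mono_right atTop_le_cocompact
  have h := (Real.tendsto_integral_exp_smul_cocompact
    ((Set.Ioc 0 (Real.pi / 2)).indicator fun a => (f a : ℂ))).comp hw
  rw [intervalIntegrable_iff_integrableOn_Ioc_of_le hp] at hf
  have hexp : ∀ (M : ℕ) (a : ℝ),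
      Complex.exp (-((2 * (M : ℝ) * a : ℝ) : ℂ) * Complex.I) * (f a : ℂ) =
      ((f a * Real.cos (2 * (M : ℝ) * a) : ℝ) : ℂ) -
        ((f a * Real.sin (2 * (M : ℝ) * a) : ℝ) : ℂ) * Complex.I := by
    intro M a
    rw [Complex.exp_mul_I, Complex.cos_neg, Complex.sin_neg, ← Complex.ofReal_cos,
      ← Complex.ofReal_sin]
    push_cast
    ring
  have hint : ∀ g : ℝ → ℝ, Continuous g → (∀ a, |g a| ≤ 1) →
      MeasureTheory.IntegrableOn (fun a => f a * g a) (Set.Ioc 0 (Real.pi / 2)) := by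
    intro g hg hb
    exact MeasureTheory.Integrable.mul_bdd (c := 1) hf hg.aestronglyMeasurable
      (Eventually.of_forall fun a => hb a)
  have heq : ∀ M : ℕ, ∫ v : ℝ, (Real.fourierChar (-(v * ((M : ℝ) / Real.pi)))) •
      ((Set.Ioc 0 (Real.pi / 2)).indicator fun a => (f a : ℂ)) v =
      ((∫ a in (0 : ℝ)..Real.pi / 2, f a * Real.cos (2 * (M : ℝ) * a) : ℝ) : ℂ) -
        ((∫ a in (0 : ℝ)..Real.pi / 2, f a * Real.sin (2 * (M : ℝ) * a) : ℝ) : ℂ) * Complex.I := by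
    intro M
    rw [intervalIntegral.integral_of_le hp, intervalIntegral.integral_of_le hp,
      ← integral_complex_ofReal, ← integral_complex_ofReal, ← MeasureTheory.integral_mul_const,
      ← MeasureTheory.integral_sub, ← MeasureTheory.integral_indicator measurableSet_Ioc]
    · refine MeasureTheory.integral_congr_ae (Eventually.of_forall fun a => ?_)
      simp only [Set.indicator]
      split_ifs
      · rw [← hexp, Circle.smul_def, Real.fourierChar_apply, smul_eq_mul]
        congr 3
        push_cast
        have : (Real.pi : ℂ) ≠ 0 := Complex.ofReal_ne_zero.mpr Real.pi_ne_zero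
        field_simp
      · exact smul_zero _
    · exact (hint _ (by fun_prop) fun a => Real.abs_cos_le_one _).ofReal
    · exact (hint _ (by fun_prop) fun a => Real.abs_sin_le_one _).ofReal.mul_const _
  have h' := h.congr heq
  constructor
  · have := (Complex.continuous_re.tendsto _).comp h'
    simpa [Function.comp_def] using this
  · have := ((Complex.continuous_im.tendsto _).comp h').neg
    simpa [Function.comp_def] using this

theorem dirichletBeta_one : dirichletBeta 1 = Real.pi / 4 := by
  refine tendsto_nhds_unique (tendsto_dirichletBeta le_rfl) ?_
  simpa using Real.tendsto_sum_pi_div_four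

/-- The Dirichlet kernel `sin ((2 n + 1) a) / sin a`. -/
noncomputable def oddDirichletKernel (n : ℕ) (a : ℝ) : ℝ :=
  1 + ∑ k ∈ Finset.range n, 2 * Real.cos (2 * ((k : ℝ) + 1) * a)

theorem oddDirichletKernel_mul_sin (n : ℕ) (a : ℝ) :
    oddDirichletKernel n a * Real.sin a = Real.sin ((2 * (n : ℝ) + 1) * a) := by
  induction n with
  | zero => simp [oddDirichletKernel]
  | succ n ih =>
    rw [oddDirichletKernel, Finset.sum_range_succ, ← add_assoc, add_mul, ← oddDirichletKernel, ih]
    have e1 : (2 * ((n + 1 : ℕ) : ℝ) + 1) * a = 2 * ((n : ℝ) + 1) * a + a := by push_cast; ring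
    have e2 : (2 * (n : ℝ) + 1) * a = 2 * ((n : ℝ) + 1) * a - a := by ring
    rw [e1, e2, Real.sin_add, Real.sin_sub]
    ring

theorem abs_oddDirichletKernel_le (n : ℕ) (a : ℝ) : |oddDirichletKernel n a| ≤ 2 * (n : ℝ) + 1 := by
  calc |oddDirichletKernel n a|
      ≤ |1| + |∑ k ∈ Finset.range n, 2 * Real.cos (2 * ((k : ℝ) + 1) * a)| := abs_add_le _ _
    _ ≤ 1 + ∑ k ∈ Finset.range n, 2 := by
        rw [abs_one]
        gcongr
        refine (Finset.abs_sum_le_sum_abs _ _).trans (Finset.sum_le_sum fun k _ => ?_)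
        rw [abs_mul, abs_two]
        linarith [Real.abs_cos_le_one (2 * ((k : ℝ) + 1) * a)]
    _ = 2 * (n : ℝ) + 1 := by simp; ring

theorem continuous_oddDirichletKernel (n : ℕ) : Continuous (oddDirichletKernel n) := by
  unfold oddDirichletKernel
  fun_prop

theorem integral_oddDirichletKernel (n : ℕ) :
    ∫ a in (0 : ℝ)..Real.pi / 2, oddDirichletKernel n a = Real.pi / 2 := by
  unfold oddDirichletKernel
  rw [intervalIntegral.integral_add (Continuous.intervalIntegrable (by fun_prop) _ _)
    (Continuous.intervalIntegrable (by fun_prop) _ _), intervalIntegral.integral_finsetSum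
    (fun k _ => Continuous.intervalIntegrable (by fun_prop) _ _), Finset.sum_eq_zero]
  · simp
  · intro k _
    have hk : (2 * ((k : ℝ) + 1)) ≠ 0 := by positivity
    have h := intervalIntegral.integral_eq_sub_of_hasDerivAt (a := 0) (b := Real.pi / 2)
      (f := fun a : ℝ => Real.sin ((2 * ((k : ℝ) + 1)) * a))
      (fun a _ => hasDerivAt_sin_mul (2 * ((k : ℝ) + 1)) a)
      (Continuous.intervalIntegrable (by fun_prop) _ _)
    have e : 2 * ((k : ℝ) + 1) * (Real.pi / 2) = ((k + 1 : ℕ) : ℝ) * Real.pi := by push_cast; ring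
    rw [intervalIntegral.integral_const_mul, e, Real.sin_nat_mul_pi, mul_zero, Real.sin_zero,
      sub_zero] at h
    rw [intervalIntegral.integral_const_mul, (mul_eq_zero.mp h).resolve_left hk, mul_zero]

theorem two_mul_sum_cos_mul_sin (K : ℕ) (a : ℝ) :
    (∑ n ∈ Finset.range K, 2 * Real.cos ((2 * (n : ℝ) + 1) * a)) * Real.sin a =
      Real.sin (2 * (K : ℝ) * a) := by
  induction K with
  | zero => simp
  | succ K ih =>
    rw [Finset.sum_range_succ, add_mul, ih]
    have e1 : 2 * ((K + 1 : ℕ) : ℝ) * a = (2 * (K : ℝ) + 1) * a + a := by push_cast; ring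
    have e2 : 2 * (K : ℝ) * a = (2 * (K : ℝ) + 1) * a - a := by ring
    rw [e1, e2, Real.sin_add, Real.sin_sub]
    ring

theorem two_mul_sum_sin_mul_sin (K : ℕ) (a : ℝ) :
    (∑ n ∈ Finset.range K, 2 * Real.sin ((2 * (n : ℝ) + 1) * a)) * Real.sin a =
      1 - Real.cos (2 * (K : ℝ) * a) := by
  induction K with
  | zero => simp
  | succ K ih =>
    rw [Finset.sum_range_succ, add_mul, ih]
    have e1 : 2 * ((K + 1 : ℕ) : ℝ) * a = (2 * (K : ℝ) + 1) * a + a := by push_cast; ring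
    have e2 : 2 * (K : ℝ) * a = (2 * (K : ℝ) + 1) * a - a := by ring
    rw [e1, e2, Real.cos_add, Real.cos_sub]
    ring

theorem intervalIntegrable_pow_div_sin (p : ℕ) :
    IntervalIntegrable (fun a : ℝ => a ^ (p + 1) / (p + 1).factorial / Real.sin a)
      MeasureTheory.volume 0 (Real.pi / 2) := by
  have hp : (0 : ℝ) ≤ Real.pi / 2 := by positivity
  rw [intervalIntegrable_iff_integrableOn_Ioc_of_le hp]
  refine MeasureTheory.Measure.integrableOn_of_bounded (M := (Real.pi / 2) ^ (p + 1))
    (by simp) (Measurable.aestronglyMeasurable (by fun_prop)) ?_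
  refine MeasureTheory.ae_restrict_of_forall_mem measurableSet_Ioc fun a ha => ?_
  have hsin : 2 / Real.pi * a ≤ Real.sin a := Real.mul_le_sin ha.1.le ha.2
  have hpos : 0 < 2 / Real.pi * a := mul_pos (by positivity) ha.1
  have h0 := ha.1
  have hfac : (1 : ℝ) ≤ (p + 1).factorial := by exact_mod_cast (p + 1).factorial_pos
  rw [Real.norm_of_nonneg (by have := hpos.trans_le hsin; positivity)]
  calc a ^ (p + 1) / (p + 1).factorial / Real.sin a
      ≤ a ^ (p + 1) / 1 / (2 / Real.pi * a) := by gcongr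
    _ = a ^ p * (Real.pi / 2) := by field_simp; ring
    _ ≤ (Real.pi / 2) ^ p * (Real.pi / 2) := by
      have := ha.2
      gcongr
    _ = _ := by rw [pow_succ]

theorem ae_sin_ne_zero : ∀ᵐ a ∂MeasureTheory.volume, a ∈ Set.uIoc 0 (Real.pi / 2) →
    Real.sin a ≠ 0 := by
  refine Eventually.of_forall fun a ha => ?_
  rw [Set.uIoc_of_le (by positivity)] at ha
  exact (Real.sin_pos_of_pos_of_lt_pi ha.1 (by linarith [ha.2, Real.pi_pos])).ne'

/-- The moments of `2 ∑_{n < K} cos ((2 n + 1) a) = sin (2 K a) / sin a` against a positive power of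
`a` tend to `0`, because `a ^ (p + 1) / sin a` is integrable and `sin (2 K a)` oscillates. -/
theorem tendsto_sum_cosMoment (p : ℕ) :
    Tendsto (fun K : ℕ => ∑ n ∈ Finset.range K, 2 * cosMoment (p + 1) n) atTop (𝓝 0) := by
  refine (tendsto_integral_mul_cos_sin (intervalIntegrable_pow_div_sin p)).2.congr fun K => ?_
  simp_rw [cosMoment, ← intervalIntegral.integral_const_mul]
  rw [← intervalIntegral.integral_finsetSum
    fun n _ => Continuous.intervalIntegrable (by fun_prop) _ _]
  refine intervalIntegral.integral_congr_ae ?_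
  filter_upwards [ae_sin_ne_zero] with a ha hmem
  have h := ha hmem
  rw [← two_mul_sum_cos_mul_sin, Finset.sum_mul, Finset.mul_sum]
  refine Finset.sum_congr rfl fun n _ => ?_
  field_simp

/-- Since `2 ∑_{n < K} sin ((2 n + 1) a) = (1 - cos (2 K a)) / sin a`, its moments tend to those of
`1 / sin a`. -/
theorem tendsto_sum_sinMoment (p : ℕ) :
    Tendsto (fun K : ℕ => ∑ n ∈ Finset.range K, 2 * sinMoment (p + 1) n) atTop
      (𝓝 (∫ a in (0 : ℝ)..Real.pi / 2, a ^ (p + 1) / (p + 1).factorial / Real.sin a)) := by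
  have hi := intervalIntegrable_pow_div_sin p
  have h := (tendsto_integral_mul_cos_sin hi).1.const_sub
    (∫ a in (0 : ℝ)..Real.pi / 2, a ^ (p + 1) / (p + 1).factorial / Real.sin a)
  rw [sub_zero] at h
  refine h.congr fun K => ?_
  simp_rw [sinMoment, ← intervalIntegral.integral_const_mul]
  rw [← intervalIntegral.integral_finsetSum
    fun n _ => Continuous.intervalIntegrable (by fun_prop) _ _, ← intervalIntegral.integral_sub hi
    (hi.mul_continuousOn (by fun_prop))]
  refine intervalIntegral.integral_congr_ae ?_
  filter_upwards [ae_sin_ne_zero] with a ha hmem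
  have h := ha hmem
  rw [← mul_one_sub, ← two_mul_sum_sin_mul_sin, Finset.sum_mul, Finset.mul_sum]
  refine Finset.sum_congr rfl fun n _ => ?_
  field_simp

theorem tendsto_sum_cosMoment_two_mul (M d : ℕ) :
    Tendsto (fun K : ℕ => ∑ n ∈ Finset.range K, 2 * (cosMoment (2 * M) n / (2 * (n : ℝ) + 1) ^ d))
      atTop (𝓝 (2 * ∑ k ∈ Finset.range (M + 1), (-1) ^ (M - k) *
        ((Real.pi / 2) ^ (2 * k) / (2 * k).factorial) * dirichletBeta (2 * (M - k) + 1 + d))) := by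
  have h := (tendsto_finsetSum (Finset.range (M + 1)) fun k _ =>
    (tendsto_dirichletBeta (s := 2 * (M - k) + 1 + d) (by omega)).const_mul
      ((-1) ^ (M - k) * ((Real.pi / 2) ^ (2 * k) / (2 * k).factorial))).const_mul 2
  refine h.congr fun K => ?_
  simp_rw [Finset.mul_sum]
  rw [Finset.sum_comm]
  refine Finset.sum_congr rfl fun n _ => ?_
  rw [cosMoment_two_mul, Finset.sum_div, Finset.mul_sum]
  refine Finset.sum_congr rfl fun k _ => ?_
  rw [pow_add _ _ d]
  field_simp

/-- The coefficients of positive degree in `cos (π x / 2) * ∑ β (2 k + 1) x ^ (2 k) = π / 4`. -/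
theorem sum_dirichletBeta_odd (M : ℕ) :
    ∑ k ∈ Finset.range (M + 2), (-1) ^ k * ((Real.pi / 2) ^ (2 * k) / (2 * k).factorial) *
      dirichletBeta (2 * (M + 1 - k) + 1) = 0 := by
  have h1 := tendsto_sum_cosMoment_two_mul (M + 1) 0
  simp only [pow_zero, div_one, add_zero] at h1
  have h2 := tendsto_nhds_unique h1 (tendsto_sum_cosMoment (2 * M + 1))
  have h3 := (mul_eq_zero.mp h2).resolve_left two_ne_zero
  rw [← mul_zero ((-1 : ℝ) ^ (M + 1)), ← h3, Finset.mul_sum]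
  refine Finset.sum_congr rfl fun k hk => ?_
  have hk' : M + 1 = (M + 1 - k) + k := by
    have := Finset.mem_range.mp hk
    omega
  have hs : (-1 : ℝ) ^ (M + 1) * (-1) ^ (M + 1 - k) = (-1) ^ k := by
    nth_rewrite 1 [hk']
    rw [pow_add, mul_right_comm, ← mul_pow]
    norm_num
  rw [← hs]
  ring

/-- The odd moments of `1 / sin a` are combinations of beta values at even integers. -/
theorem integral_pow_div_sin (i : ℕ) :
    ∫ a in (0 : ℝ)..Real.pi / 2, a ^ (2 * i + 1) / (2 * i + 1).factorial / Real.sin a =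
      2 * ∑ k ∈ Finset.range (i + 1), (-1) ^ (i - k) *
        ((Real.pi / 2) ^ (2 * k) / (2 * k).factorial) * dirichletBeta (2 * (i - k) + 2) := by
  refine tendsto_nhds_unique (tendsto_sum_sinMoment (2 * i)) ?_
  simp_rw [sinMoment_succ]
  simpa only [pow_one] using tendsto_sum_cosMoment_two_mul i 1

/-- `β (2 M + 1)` is a rational multiple of `π ^ (2 M + 1)`: solve `sum_dirichletBeta_odd` for its
term of index `0`. -/
theorem exists_rat_dirichletBeta_odd (M : ℕ) :
    ∃ q : ℚ, dirichletBeta (2 * M + 1) = q * Real.pi ^ (2 * M + 1) := by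
  induction M using Nat.strong_induction_on with
  | _ M ih =>
    rcases M with _ | M
    · exact ⟨1 / 4, by rw [mul_zero, zero_add, dirichletBeta_one]; push_cast; ring⟩
    · have h := sum_dirichletBeta_odd M
      rw [Finset.sum_range_succ'] at h
      have ih' : ∀ k, ∃ q : ℚ, k ∈ Finset.range (M + 1) →
          dirichletBeta (2 * (M + 1 - (k + 1)) + 1) =
            q * Real.pi ^ (2 * (M + 1 - (k + 1)) + 1) := by
        intro k
        by_cases hk : k ∈ Finset.range (M + 1)
        · obtain ⟨q, hq⟩ := ih (M + 1 - (k + 1)) (by omega)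
          exact ⟨q, fun _ => hq⟩
        · exact ⟨0, fun h => absurd h hk⟩
      choose q hq using ih'
      refine ⟨-∑ k ∈ Finset.range (M + 1), (-1) ^ (k + 1) *
        ((1 / 2) ^ (2 * (k + 1)) / (2 * (k + 1)).factorial) * q k, ?_⟩
      push_cast
      rw [neg_mul, Finset.sum_mul]
      have e : ∑ k ∈ Finset.range (M + 1), (-1) ^ (k + 1) *
          ((Real.pi / 2) ^ (2 * (k + 1)) / (2 * (k + 1)).factorial) *
            dirichletBeta (2 * (M + 1 - (k + 1)) + 1) =
          ∑ k ∈ Finset.range (M + 1), (-1) ^ (k + 1) *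
        ((1 / 2) ^ (2 * (k + 1)) / (2 * (k + 1)).factorial) * (q k : ℝ) *
          Real.pi ^ (2 * (M + 1) + 1) := by
        refine Finset.sum_congr rfl fun k hk => ?_
        have hk' : 2 * (M + 1) + 1 = 2 * (M + 1 - (k + 1)) + 1 + 2 * (k + 1) := by
          have := Finset.mem_range.mp hk
          omega
        rw [hq k hk, hk', pow_add _ _ (2 * (k + 1)), div_pow, div_pow, one_pow]
        ring
      rw [← e]
      simp only [pow_zero, mul_zero, Nat.factorial_zero, Nat.cast_one, div_one, mul_one, one_mul,
        Nat.sub_zero] at h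
      linear_combination h

/-! ### Fourier series of the generating functions -/

/-- The `k`-fold iterated antiderivative of `cos (c a)`, all integration constants chosen such that
the antiderivatives vanish at `0`. -/
noncomputable def cosPrimitive (c : ℝ) : ℕ → ℝ → ℝ
  | 0, a => Real.cos (c * a)
  | 1, a => Real.sin (c * a) / c
  | k + 2, a => (a ^ k / k.factorial - cosPrimitive c k a) / c ^ 2

theorem hasDerivAt_cosPrimitive {c : ℝ} (hc : c ≠ 0) (k : ℕ) (a : ℝ) :
    HasDerivAt (cosPrimitive c (k + 1)) (cosPrimitive c k a) a := by
  induction k using Nat.twoStepInduction with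
  | zero =>
    have := (hasDerivAt_sin_mul c a).div_const c
    rw [mul_div_cancel_left₀ _ hc] at this
    exact this
  | one =>
    have := ((hasDerivAt_cos_mul c a).const_sub 1).div_const (c ^ 2)
    have e : cosPrimitive c 2 = fun x => (1 - Real.cos (c * x)) / c ^ 2 := by
      funext x
      simp [cosPrimitive]
    rw [e]
    convert! this using 1
    simp only [cosPrimitive]
    field_simp
  | more k ih _ =>
    exact ((hasDerivAt_pow_div_factorial k a).sub ih).div_const (c ^ 2)

theorem cosPrimitive_succ_zero (c : ℝ) (k : ℕ) : cosPrimitive c (k + 1) 0 = 0 := by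
  induction k using Nat.twoStepInduction with
  | zero => simp [cosPrimitive]
  | one => simp [cosPrimitive]
  | more k ih _ =>
    rw [cosPrimitive, ih, zero_pow k.succ_ne_zero, zero_div, sub_zero, zero_div]

theorem cosPrimitive_two_mul_add_one {c : ℝ} (hc : c ≠ 0) (m : ℕ) (a : ℝ) :
    cosPrimitive c (2 * m + 1) a = (-1) ^ m * (Real.sin (c * a) / c ^ (2 * m + 1) -
      ∑ i ∈ Finset.range m, (-1) ^ i * (a ^ (2 * i + 1) / (2 * i + 1).factorial) /
        c ^ (2 * (m - i))) := by
  induction m with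
  | zero => simp [cosPrimitive]
  | succ m ih =>
    rw [show 2 * (m + 1) + 1 = 2 * m + 1 + 2 by ring, cosPrimitive, ih, Finset.sum_range_succ]
    have e : ∑ i ∈ Finset.range m, (-1) ^ i * (a ^ (2 * i + 1) / (2 * i + 1).factorial) /
        c ^ (2 * (m + 1 - i)) = (∑ i ∈ Finset.range m, (-1) ^ i *
          (a ^ (2 * i + 1) / (2 * i + 1).factorial) / c ^ (2 * (m - i))) / c ^ 2 := by
      rw [Finset.sum_div]
      refine Finset.sum_congr rfl fun i hi => ?_
      have hi' : m + 1 - i = (m - i) + 1 := by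
        have := Finset.mem_range.mp hi
        omega
      rw [hi', div_div, mul_add 2, pow_add c]
    have e1 : m + 1 - m = 1 := by omega
    have e2 : (-1 : ℝ) ^ m * (-1) ^ m = 1 := by rw [← mul_pow]; norm_num
    rw [e, e1, pow_succ (-1 : ℝ) m, pow_add c (2 * m + 1) 2, mul_one]
    field_simp
    linear_combination (-(a ^ (2 * m + 1) * c ^ (2 * m + 1))) * e2

/-- The partial sums of the formal Fourier series `∑ 2 (-1) ^ n cos ((2 n + 1) a)` of `1 / cos a`,
integrated `k` times from `0`. -/
noncomputable def secPartial (k M : ℕ) (a : ℝ) : ℝ :=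
  ∑ n ∈ Finset.range M, 2 * (-1) ^ n * cosPrimitive (2 * (n : ℝ) + 1) k a

theorem hasDerivAt_secPartial (k M : ℕ) (a : ℝ) :
    HasDerivAt (secPartial (k + 1) M) (secPartial k M a) a :=
  HasDerivAt.fun_sum fun n _ =>
    (hasDerivAt_cosPrimitive (two_mul_add_one_pos n).ne' k a).const_mul _

theorem secPartial_succ_zero (k M : ℕ) : secPartial (k + 1) M 0 = 0 :=
  Finset.sum_eq_zero fun n _ => by rw [cosPrimitive_succ_zero, mul_zero]

theorem secPartial_zero_mul_cos (M : ℕ) (a : ℝ) :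
    secPartial 0 M a * Real.cos a = 1 - (-1) ^ M * Real.cos (2 * (M : ℝ) * a) := by
  induction M with
  | zero => simp [secPartial]
  | succ K ih =>
    rw [secPartial, Finset.sum_range_succ, ← secPartial, add_mul, ih, cosPrimitive]
    have e1 : 2 * ((K + 1 : ℕ) : ℝ) * a = (2 * (K : ℝ) + 1) * a + a := by push_cast; ring
    have e2 : 2 * (K : ℝ) * a = (2 * (K : ℝ) + 1) * a - a := by ring
    rw [e1, e2, Real.cos_add, Real.cos_sub, pow_succ]
    ring

theorem abs_le_mul_of_hasDerivAt {f f' : ℝ → ℝ} {b C : ℝ}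
    (hf : ∀ x ∈ Set.Icc 0 b, HasDerivAt f (f' x) x) (hC : ∀ x ∈ Set.Icc 0 b, |f' x| ≤ C)
    (h0 : f 0 = 0) {a : ℝ} (ha : a ∈ Set.Icc 0 b) : |f a| ≤ C * a := by
  have := (convex_Icc (0 : ℝ) b).norm_image_sub_le_of_norm_hasDerivWithin_le
    (fun x hx => (hf x hx).hasDerivWithinAt) hC ⟨le_rfl, ha.1.trans ha.2⟩ ha
  rwa [h0, sub_zero, sub_zero, Real.norm_eq_abs, Real.norm_eq_abs, abs_of_nonneg ha.1] at this

/-- The partial Fourier sums converge to the generating functions uniformly on `[0, b]`. In depth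
one the error is an integral of `cos (2 M a) / cos a`, hence `O(1 / M)`; integration preserves the
bound. -/
theorem exists_abs_chainGen_sub_secPartial_le (k : ℕ) {b : ℝ} (hb : b < Real.pi / 2) :
    ∃ C, ∀ M : ℕ, 0 < M → ∀ a ∈ Set.Icc 0 b, |chainGen k a - secPartial (k + 1) M a| ≤ C / M := by
  have habs : ∀ a ∈ Set.Icc 0 b, |a| < Real.pi / 2 := fun a ha => by
    rw [abs_of_nonneg ha.1]
    exact ha.2.trans_lt hb
  rcases lt_or_ge b 0 with hb0 | hb0
  · exact ⟨0, fun M _ a ha => absurd (ha.1.trans ha.2) (not_le.mpr hb0)⟩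
  induction k with
  | zero =>
    set c := Real.cos b with hc
    have hcb : 0 < c := Real.cos_pos_of_mem_Ioo ⟨by linarith [Real.pi_pos], hb⟩
    have hcos : ∀ a ∈ Set.Icc 0 b, c ≤ Real.cos a := fun a ha =>
      Real.cos_le_cos_of_nonneg_of_le_pi ha.1 (by linarith [Real.pi_pos]) ha.2
    refine ⟨1 / (2 * c ^ 2) * b + 1 / (2 * c), fun M hM a ha => ?_⟩
    have hM' : (0 : ℝ) < M := by exact_mod_cast hM
    -- integration by parts moves the oscillating error term to one that is uniformly `O(1 / M)`
    let g : ℝ → ℝ := fun a => (-1) ^ M * (Real.sin (2 * (M : ℝ) * a) / (2 * M * Real.cos a))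
    have hg : ∀ x ∈ Set.Icc 0 b, HasDerivAt (fun x => chainGen 0 x - secPartial 1 M x - g x)
        (-((-1) ^ M * (Real.sin (2 * (M : ℝ) * x) * Real.sin x / (2 * M * Real.cos x ^ 2)))) x := by
      intro x hx
      have hx0 : Real.cos x ≠ 0 := (hcb.trans_le (hcos x hx)).ne'
      have h1 := (hasDerivAt_sin_mul (2 * (M : ℝ)) x).div
        ((Real.hasDerivAt_cos x).const_mul (2 * (M : ℝ))) (by positivity)
      have h2 := ((hasDerivAt_chainGen_zero (habs x hx)).sub (hasDerivAt_secPartial 0 M x)).sub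
        (h1.const_mul ((-1) ^ M))
      convert! h2 using 1
      have h3 := secPartial_zero_mul_cos M x
      rw [← eq_div_iff hx0] at h3
      rw [h3]
      field_simp
      ring
    have hbd := abs_le_mul_of_hasDerivAt hg (C := 1 / (2 * M * c ^ 2)) (fun x hx => ?_) ?_ ha
    · have hga : |g a| ≤ 1 / (2 * M * c) := by
        have := hcos a ha
        have h5 := hcb.trans_le this
        rw [abs_mul, abs_pow, abs_neg, abs_one, one_pow, one_mul, abs_div,
          abs_of_pos (by positivity : 0 < 2 * (M : ℝ) * Real.cos a)]
        gcongr
        exact Real.abs_sin_le_one _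
      have h6 : 1 / (2 * M * c ^ 2) * a ≤ 1 / (2 * M * c ^ 2) * b := by
        have := ha.2
        gcongr
      have h7 := abs_add_le (chainGen 0 a - secPartial 1 M a - g a) (g a)
      rw [sub_add_cancel] at h7
      calc |chainGen 0 a - secPartial (0 + 1) M a|
          ≤ 1 / (2 * M * c ^ 2) * b + 1 / (2 * M * c) := by
            rw [zero_add]
            linarith
        _ = _ := by field_simp
    · have := hcos x hx
      have h5 := hcb.trans_le this
      rw [abs_neg, abs_mul, abs_pow, abs_neg, abs_one, one_pow, one_mul, abs_div, abs_mul,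
        abs_of_pos (by positivity : 0 < 2 * (M : ℝ) * Real.cos x ^ 2)]
      gcongr
      exact mul_le_one₀ (Real.abs_sin_le_one _) (abs_nonneg _) (Real.abs_sin_le_one _)
    · simp [g, chainGen_zero_right, secPartial_succ_zero 0 M]
  | succ k ih =>
    obtain ⟨C, hC⟩ := ih
    refine ⟨C * b, fun M hM a ha => ?_⟩
    have hM' : (0 : ℝ) < M := by exact_mod_cast hM
    have := abs_le_mul_of_hasDerivAt (b := b) (C := C / M)
      (f := fun x => chainGen (k + 1) x - secPartial (k + 1 + 1) M x)
      (fun x hx => (hasDerivAt_chainGen_succ k (habs x hx)).sub (hasDerivAt_secPartial (k + 1) M x))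
      (hC M hM) (by rw [chainGen_zero_right, secPartial_succ_zero, sub_zero]) ha
    refine this.trans ?_
    have hC0 : 0 ≤ C / M := (abs_nonneg _).trans (hC M hM a ha)
    calc C / M * a ≤ C / M * b := mul_le_mul_of_nonneg_left ha.2 hC0
      _ = C * b / M := by ring

theorem tendsto_secPartial (k : ℕ) {a : ℝ} (h0 : 0 ≤ a) (ha : a < Real.pi / 2) :
    Tendsto (fun M => secPartial (k + 1) M a) atTop (𝓝 (chainGen k a)) := by
  obtain ⟨C, hC⟩ := exists_abs_chainGen_sub_secPartial_le k ha
  have hlim : Tendsto (fun M : ℕ => C / (M : ℝ)) atTop (𝓝 0) :=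
    tendsto_const_nhds.div_atTop tendsto_natCast_atTop_atTop
  rw [tendsto_iff_norm_sub_tendsto_zero]
  refine squeeze_zero' (Eventually.of_forall fun _ => norm_nonneg _) ?_ hlim
  filter_upwards [eventually_gt_atTop 0] with M hM
  rw [norm_sub_rev]
  exact hC M hM a ⟨h0, le_rfl⟩

theorem summable_one_div_odd_pow {s : ℕ} (hs : 2 ≤ s) :
    Summable fun n : ℕ => 1 / (2 * (n : ℝ) + 1) ^ s := by
  have h := (Real.summable_one_div_nat_pow (p := s)).mpr hs
  have := h.comp_injective (i := fun n : ℕ => 2 * n + 1) fun a b hab => by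
    dsimp only at hab
    omega
  simpa [Function.comp_def] using this

theorem hasSum_dirichletBeta {s : ℕ} (hs : 2 ≤ s) :
    HasSum (fun n : ℕ => (-1 : ℝ) ^ n / (2 * (n : ℝ) + 1) ^ s) (dirichletBeta s) := by
  have hsum : Summable fun n : ℕ => (-1 : ℝ) ^ n / (2 * (n : ℝ) + 1) ^ s := by
    refine Summable.of_norm_bounded (summable_one_div_odd_pow hs) fun n => ?_
    have := two_mul_add_one_pos n
    rw [norm_div, norm_pow, norm_neg, norm_one, one_pow, Real.norm_of_nonneg (by positivity)]
  rw [← tendsto_nhds_unique hsum.hasSum.tendsto_sum_nat (tendsto_dirichletBeta (by omega))]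
  exact hsum.hasSum

/-- The closed form of the generating function: a convergent Fourier series minus its Taylor
polynomial, whose coefficients are beta values at even integers. -/
theorem chainGen_two_mul {m : ℕ} (hm : 1 ≤ m) {a : ℝ} (h0 : 0 ≤ a) (ha : a < Real.pi / 2) :
    chainGen (2 * m) a = (-1) ^ m * (2 * ∑' n : ℕ, (-1) ^ n * Real.sin ((2 * (n : ℝ) + 1) * a) /
        (2 * (n : ℝ) + 1) ^ (2 * m + 1) -
      2 * ∑ i ∈ Finset.range m, (-1) ^ i * (a ^ (2 * i + 1) / (2 * i + 1).factorial) *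
        dirichletBeta (2 * (m - i))) := by
  have hs : Summable fun n : ℕ => (-1) ^ n * Real.sin ((2 * (n : ℝ) + 1) * a) /
      (2 * (n : ℝ) + 1) ^ (2 * m + 1) := by
    refine Summable.of_norm_bounded (summable_one_div_odd_pow (s := 2 * m + 1) (by omega))
      fun n => ?_
    have := two_mul_add_one_pos n
    rw [norm_div, norm_mul, norm_pow, norm_neg, norm_one, one_pow, one_mul,
      Real.norm_of_nonneg (by positivity : 0 ≤ (2 * (n : ℝ) + 1) ^ (2 * m + 1))]
    gcongr
    exact Real.abs_sin_le_one _
  have hb : ∀ i ∈ Finset.range m, HasSum (fun n : ℕ => (-1) ^ i *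
      (a ^ (2 * i + 1) / (2 * i + 1).factorial) * ((-1) ^ n / (2 * (n : ℝ) + 1) ^ (2 * (m - i))))
      ((-1) ^ i * (a ^ (2 * i + 1) / (2 * i + 1).factorial) * dirichletBeta (2 * (m - i))) := by
    intro i hi
    have := Finset.mem_range.mp hi
    exact (hasSum_dirichletBeta (by omega)).mul_left _
  have h := (((hs.hasSum.mul_left 2).sub ((hasSum_sum hb).mul_left 2)).mul_left
    ((-1) ^ m)).tendsto_sum_nat
  refine tendsto_nhds_unique (tendsto_secPartial (2 * m) h0 ha) (h.congr fun M => ?_)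
  refine Finset.sum_congr rfl fun n _ => ?_
  rw [cosPrimitive_two_mul_add_one (two_mul_add_one_pos n).ne']
  have e : ∑ i ∈ Finset.range m, (-1) ^ i * (a ^ (2 * i + 1) / (2 * i + 1).factorial) *
      ((-1) ^ n / (2 * (n : ℝ) + 1) ^ (2 * (m - i))) = (-1) ^ n * ∑ i ∈ Finset.range m, (-1) ^ i *
        (a ^ (2 * i + 1) / (2 * i + 1).factorial) / (2 * (n : ℝ) + 1) ^ (2 * (m - i)) := by
    rw [Finset.mul_sum]
    refine Finset.sum_congr rfl fun i _ => ?_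
    ring
  rw [e]
  ring

/-! ### The multiple T-value as a sum over its largest index -/

/-- The `n`-th factor in the `i`-th position of the terms of `T(2̄, {1}_{2m-1}, 1̄)`. -/
noncomputable def factor211 (m : ℕ) (i : Fin (2 * m + 1)) (n : ℕ) : ℝ :=
  ((1 + ((mtvParity (2 * m + 1) i : ℤ) : ℝ) * (-1) ^ n) *
    (((signs211 m i ^ ((2 * (n : ℤ) + 1 - (mtvParity (2 * m + 1) i : ℤ)) / 4) : ℤˣ) : ℤ) : ℝ)) /
      (n : ℝ) ^ args211 m i

theorem ammvTerm_eq_prod_factor211 (m : ℕ) (f : Fin (2 * m + 1) → ℕ) :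
    ammvTerm (mtvParity (2 * m + 1)) (signs211 m) (args211 m) f = ∏ i, factor211 m i (f i) := rfl

theorem cast_mtvParity (r : ℕ) (i : Fin r) : ((mtvParity r i : ℤ) : ℝ) = (-1) ^ (r - (i : ℕ)) := by
  simp [mtvParity]

theorem abs_cast_intUnits (u : ℤˣ) : |((u : ℤ) : ℝ)| = 1 := by
  rcases Int.units_eq_one_or u with rfl | rfl <;> simp

theorem abs_factor211_le (m : ℕ) (i : Fin (2 * m + 1)) (n : ℕ) :
    |factor211 m i n| ≤ 2 / (n : ℝ) ^ args211 m i := by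
  rw [factor211, abs_div, abs_mul, abs_cast_intUnits, mul_one, abs_pow, Nat.abs_cast,
    cast_mtvParity]
  gcongr
  exact abs_one_add_pow_mul_le _ _

/-- The exponent of a sign `σ = -1` in a position of odd parity `ε = -1` is `(n + 1) / 2`. -/
theorem cast_neg_one_zpow (n : ℕ) :
    ((((-1 : ℤˣ) ^ ((2 * (n : ℤ) + 1 - ((-1 : ℤˣ) : ℤ)) / 4) : ℤˣ) : ℤ) : ℝ) =
      (-1) ^ ((n + 1) / 2) := by
  have h : (2 * (n : ℤ) + 1 - ((-1 : ℤˣ) : ℤ)) / 4 = ((n + 1) / 2 : ℕ) := by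
    push_cast
    omega
  rw [h, zpow_natCast]
  simp

theorem factor211_zero (m n : ℕ) :
    factor211 m 0 n = (1 - (-1) ^ n) / (n : ℝ) ^ 2 * (-1) ^ ((n + 1) / 2) := by
  have h1 : mtvParity (2 * m + 1) 0 = -1 := by
    simp [mtvParity, pow_succ, pow_mul]
  have h2 : signs211 m 0 = -1 := if_pos (Or.inl rfl)
  have h3 : args211 m 0 = 2 := if_pos rfl
  rw [factor211, h1, h2, h3, cast_neg_one_zpow]
  push_cast
  ring

theorem factor211_last {m : ℕ} (hm : 1 ≤ m) {i : Fin (2 * m + 1)} (hi : (i : ℕ) = 2 * m) (n : ℕ) :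
    factor211 m i n = (1 - (-1) ^ n) / n * (-1) ^ ((n + 1) / 2) := by
  have h0 : i ≠ 0 := fun h => by
    rw [h, Fin.val_zero] at hi
    omega
  have h1 : mtvParity (2 * m + 1) i = -1 := by
    rw [mtvParity, hi, Nat.add_sub_cancel_left, pow_one]
  have h2 : signs211 m i = -1 := if_pos (Or.inr (Fin.ext hi))
  have h3 : args211 m i = 1 := if_neg h0
  rw [factor211, h1, h2, h3, cast_neg_one_zpow]
  push_cast
  ring

theorem factor211_middle {m : ℕ} {i : Fin (2 * m + 1)} (h0 : i ≠ 0) (hi : (i : ℕ) ≠ 2 * m)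
    (n : ℕ) :
    factor211 m i n = (1 + (-1) ^ (2 * m + 1 - (i : ℕ)) * (-1) ^ n) / n := by
  have h2 : signs211 m i = 1 := if_neg fun h => h.elim h0 fun h => hi (by rw [h, Fin.val_last])
  have h3 : args211 m i = 1 := if_neg h0
  rw [factor211, h2, h3, cast_mtvParity, one_zpow]
  simp

/-- Up to the sign `(-1) ^ m`, the part of the series `T(2̄, {1}_{2m-1}, 1̄)` with largest index
`n`. -/
noncomputable def outerCoeff (m n : ℕ) : ℝ := signedChainSum (2 * m) n / n

theorem sum_decreasingChains_factor211 {m : ℕ} (hm : 1 ≤ m) (N : ℕ) :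
    ∑ f ∈ decreasingChains (2 * m + 1) N, ∏ i, factor211 m i (f i) =
      ∑ n ∈ Finset.Ico 1 N, (-1) ^ m * outerCoeff m n := by
  obtain ⟨k, rfl⟩ := Nat.exists_eq_add_of_le' hm
  rw [sum_decreasingChains_succ]
  refine Finset.sum_congr rfl fun n _ => ?_
  have h := sum_decreasingChains_eq_altChainSum (2 * k + 1) n
    (fun i => factor211 (k + 1) (Fin.succ i)) (fun i hi n => ?_) (fun n => ?_)
  · have h' : ∑ g ∈ decreasingChains (2 * (k + 1)) n, ∏ i, factor211 (k + 1) (Fin.succ i) (g i) =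
      ∑ n ∈ Finset.Ico 1 n, altChainSum (2 * k + 1) n := h
    have e1 : (n + 1 + 3 * (2 * (k + 1))) / 2 = (n + 1) / 2 + 3 * (k + 1) := by omega
    have e2 : (-1 : ℝ) ^ (k + 1) * (-1) ^ (3 * (k + 1)) = 1 :=
      (pow_add _ _ _).symm.trans (Even.neg_one_pow ⟨2 * (k + 1), by ring⟩)
    have e3 : (-1 : ℝ) ^ (2 * k + 1) = -1 := Odd.neg_one_pow ⟨k, rfl⟩
    rw [h', factor211_zero, outerCoeff, signedChainSum, e1,
      show 2 * (k + 1) = 2 * k + 1 + 1 by ring, altChainSum, pow_add _ _ (3 * (k + 1)),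
      pow_add _ _ n, e3]
    generalize (-1 : ℝ) ^ (3 * (k + 1)) = v at e2 ⊢
    generalize (-1 : ℝ) ^ (k + 1) = u at e2 ⊢
    linear_combination (-((1 - (-1) ^ n) / n ^ 2 * (-1) ^ ((n + 1) / 2) *
      ∑ j ∈ Finset.Ico 1 n, altChainSum (2 * k + 1) j)) * e2
  · have hi' : ((Fin.succ i : Fin (2 * (k + 1) + 1)) : ℕ) ≠ 2 * (k + 1) := by
      have h1 : (i : ℕ) ≠ 2 * k + 1 := fun h => hi (Fin.ext h)
      rw [Fin.val_succ]
      omega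
    rw [factor211_middle (Fin.succ_ne_zero i) hi', Fin.val_succ]
    congr 4
    omega
  · exact factor211_last hm (by rw [Fin.val_succ, Fin.val_last]; ring) n

theorem summable_twiceHarmonic_bound (m : ℕ) :
    Summable fun n : ℕ => 2 / (n : ℝ) ^ 2 * twiceHarmonic n ^ (2 * m) := by
  refine ((summable_twiceHarmonic_pow_div_sq (2 * m)).mul_left 2).congr fun n => ?_
  ring

theorem abs_outerCoeff_le (m n : ℕ) :
    |outerCoeff m n| ≤ 2 / (n : ℝ) ^ 2 * twiceHarmonic n ^ (2 * m) := by
  rw [outerCoeff, abs_div, abs_signedChainSum, Nat.abs_cast]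
  calc |altChainSum (2 * m) n| / n ≤ 2 / n * twiceHarmonic n ^ (2 * m) / n := by
        gcongr
        exact abs_altChainSum_le _ _
    _ = _ := by ring

theorem summable_outerCoeff (m : ℕ) : Summable (outerCoeff m) :=
  Summable.of_norm_bounded (summable_twiceHarmonic_bound m) (abs_outerCoeff_le m)

theorem outerCoeff_zero (m : ℕ) : outerCoeff m 0 = 0 := by
  rw [outerCoeff, Nat.cast_zero, div_zero]

theorem tendsto_ammvTrunc {m : ℕ} (hm : 1 ≤ m) :
    Tendsto (ammvTrunc (mtvParity (2 * m + 1)) (signs211 m) (args211 m)) atTop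
      (𝓝 ((-1) ^ m * ∑' n, outerCoeff m n)) := by
  have h := ((summable_outerCoeff m).hasSum.mul_left ((-1) ^ m)).tendsto_sum_nat.comp
    (tendsto_add_atTop_nat 1)
  refine h.congr fun N => ?_
  have e : ammvTrunc (mtvParity (2 * m + 1)) (signs211 m) (args211 m) N =
      ∑ f ∈ decreasingChains (2 * m + 1) (N + 1), ∏ i, factor211 m i (f i) := by
    -- `Finset.Icc 1 N` and `Finset.Ico 1 (N + 1)` agree definitionally
    rw [ammvTrunc, decreasingChains]
    rfl
  rw [e, sum_decreasingChains_factor211 hm, Function.comp_apply, Finset.sum_range_eq_add_Ico _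
    (Nat.succ_pos N), outerCoeff_zero, mul_zero, zero_add]

theorem mtv_eq_tsum_outerCoeff {m : ℕ} (hm : 1 ≤ m) :
    mtv (signs211 m) (args211 m) = (-1) ^ m * ∑' n, outerCoeff m n :=
  (tendsto_ammvTrunc hm).limUnder_eq

theorem summable_ammvTerm (m : ℕ) :
    Summable (fun n : ammvIndex (2 * m + 1) =>
      ammvTerm (mtvParity (2 * m + 1)) (signs211 m) (args211 m) n) := by
  classical
  refine Summable.of_norm (summable_of_sum_le
    (c := ∑' n : ℕ, 2 / (n : ℝ) ^ 2 * twiceHarmonic n ^ (2 * m)) (fun _ => norm_nonneg _)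
    fun u => ?_)
  obtain ⟨N, hN⟩ : ∃ N, ∀ f ∈ u, ∀ i, (f : Fin (2 * m + 1) → ℕ) i < N := by
    refine ⟨(u.sup fun f => (f : Fin (2 * m + 1) → ℕ) 0) + 1, fun f hf i => ?_⟩
    exact Nat.lt_succ_of_le ((f.2.1.antitone (Fin.zero_le i)).trans
      (Finset.le_sup (f := fun f : ammvIndex (2 * m + 1) => (f : Fin (2 * m + 1) → ℕ) 0) hf))
  have hterm : ∀ f : Fin (2 * m + 1) → ℕ,
      ‖ammvTerm (mtvParity (2 * m + 1)) (signs211 m) (args211 m) f‖ =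
        ∏ i, |factor211 m i (f i)| := fun f => by
    rw [ammvTerm_eq_prod_factor211, Real.norm_eq_abs, Finset.abs_prod]
  simp_rw [hterm]
  calc ∑ f ∈ u, ∏ i, |factor211 m i ((f : Fin (2 * m + 1) → ℕ) i)|
      = ∑ f ∈ u.map (Function.Embedding.subtype _), ∏ i, |factor211 m i (f i)| := by
        rw [Finset.sum_map]
        rfl
    _ ≤ ∑ f ∈ decreasingChains (2 * m + 1) N, ∏ i, |factor211 m i (f i)| := by
        refine Finset.sum_le_sum_of_subset_of_nonneg (fun f hf => ?_)
          fun f _ _ => Finset.prod_nonneg fun i _ => abs_nonneg _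
        obtain ⟨g, hg, rfl⟩ := Finset.mem_map.mp hf
        exact mem_decreasingChains.mpr ⟨fun i => ⟨g.2.2 i, hN g hg i⟩, g.2.1⟩
    _ = ∑ n ∈ Finset.Ico 1 N, |factor211 m 0 n| *
          ∑ g ∈ decreasingChains (2 * m) n, ∏ i, |factor211 m (Fin.succ i) (g i)| :=
        sum_decreasingChains_succ (2 * m) N fun i n => |factor211 m i n|
    _ ≤ ∑ n ∈ Finset.Ico 1 N, 2 / (n : ℝ) ^ 2 * twiceHarmonic n ^ (2 * m) := by
        refine Finset.sum_le_sum fun n _ => mul_le_mul (abs_factor211_le m 0 n) ?_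
          (Finset.sum_nonneg fun f _ => Finset.prod_nonneg fun i _ => abs_nonneg _) (by positivity)
        refine sum_decreasingChains_prod_le (2 * m) n (fun i n => |factor211 m (Fin.succ i) n|)
          (fun _ _ => abs_nonneg _) fun i n => ?_
        have := abs_factor211_le m (Fin.succ i) n
        have h3 : args211 m (Fin.succ i) = 1 := if_neg (Fin.succ_ne_zero i)
        rwa [h3, pow_one] at this
    _ ≤ _ := (summable_twiceHarmonic_bound m).sum_le_tsum _ fun n _ => by
        have := twiceHarmonic_nonneg n
        positivity

/-! ### Evaluation of the multiple T-value -/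

/-- Every Dirichlet kernel has integral `π / 2`, so this weighted series of kernels integrates to a
beta value. -/
theorem integral_tsum_oddDirichletKernel {m : ℕ} (hm : 1 ≤ m) :
    IntervalIntegrable (fun a => ∑' n : ℕ, (-1) ^ n / (2 * (n : ℝ) + 1) ^ (2 * m + 1) *
      oddDirichletKernel n a) MeasureTheory.volume 0 (Real.pi / 2) ∧
    ∫ a in (0 : ℝ)..Real.pi / 2, ∑' n : ℕ, (-1) ^ n / (2 * (n : ℝ) + 1) ^ (2 * m + 1) *
      oddDirichletKernel n a = Real.pi / 2 * dirichletBeta (2 * m + 1) := by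
  have hsum := summable_one_div_odd_pow (s := 2 * m) (by omega)
  have hbound : ∀ (n : ℕ) (a : ℝ), ‖(-1) ^ n / (2 * (n : ℝ) + 1) ^ (2 * m + 1) *
      oddDirichletKernel n a‖ ≤ 1 / (2 * (n : ℝ) + 1) ^ (2 * m) := by
    intro n a
    have hN := two_mul_add_one_pos n
    rw [norm_mul, norm_div, norm_pow, norm_neg, norm_one, one_pow,
      Real.norm_of_nonneg (by positivity : 0 ≤ (2 * (n : ℝ) + 1) ^ (2 * m + 1))]
    calc 1 / (2 * (n : ℝ) + 1) ^ (2 * m + 1) * ‖oddDirichletKernel n a‖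
        ≤ 1 / (2 * (n : ℝ) + 1) ^ (2 * m + 1) * (2 * (n : ℝ) + 1) := by
          gcongr
          exact abs_oddDirichletKernel_le n a
      _ = _ := by
          rw [pow_succ]
          field_simp
  have hcont : ∀ n : ℕ, Continuous fun a => (-1) ^ n / (2 * (n : ℝ) + 1) ^ (2 * m + 1) *
      oddDirichletKernel n a := fun n => (continuous_oddDirichletKernel n).const_mul _
  refine ⟨(continuous_tsum hcont hsum hbound).intervalIntegrable _ _, ?_⟩
  have h := intervalIntegral.hasSum_integral_of_dominated_convergence (a := 0) (b := Real.pi / 2)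
    (μ := MeasureTheory.volume)
    (fun (n : ℕ) _ => 1 / (2 * (n : ℝ) + 1) ^ (2 * m))
    (fun n => (hcont n).aestronglyMeasurable)
    (fun n => Eventually.of_forall fun a _ => hbound n a)
    (Eventually.of_forall fun _ _ => hsum) intervalIntegrable_const
    (Eventually.of_forall fun a _ => (Summable.of_norm_bounded hsum fun n => hbound n a).hasSum)
  refine h.unique ?_
  have h2 := (hasSum_dirichletBeta (s := 2 * m + 1) (by omega)).mul_left (Real.pi / 2)
  convert! h2 using 2 with n
  rw [intervalIntegral.integral_const_mul, integral_oddDirichletKernel, mul_comm]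

/-- The series `∑ outerCoeff m n * tan (a / 2) ^ n`, whose value at `a = π / 2` is the sum of the
coefficients. -/
noncomputable def outerGen (m : ℕ) (a : ℝ) : ℝ := ∑' n, outerCoeff m n * Real.tan (a / 2) ^ n

theorem continuousOn_outerGen (m : ℕ) : ContinuousOn (outerGen m) (Set.Icc 0 (Real.pi / 2)) := by
  have hp := Real.pi_pos
  refine continuousOn_tsum (u := fun n => ‖outerCoeff m n‖) (fun n => ?_)
    (summable_outerCoeff m).norm fun n a ha => ?_
  · refine continuousOn_const.mul (ContinuousOn.pow ?_ n)
    refine Real.continuousOn_tan.comp (by fun_prop) fun a ha => ?_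
    exact (Real.cos_pos_of_mem_Ioo ⟨by linarith [ha.1], by linarith [ha.2]⟩).ne'
  · rw [norm_mul, norm_pow]
    refine mul_le_of_le_one_right (norm_nonneg _) (pow_le_one₀ (norm_nonneg _) ?_)
    rcases ha.2.lt_or_eq with h | h
    · exact (abs_tan_half_lt_one (by rwa [abs_of_nonneg ha.1])).le
    · rw [h, show Real.pi / 2 / 2 = Real.pi / 4 by ring, Real.tan_pi_div_four, norm_one]

theorem outerGen_zero (m : ℕ) : outerGen m 0 = 0 := by
  rw [outerGen, zero_div, Real.tan_zero]
  convert tsum_zero with n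
  rcases n with _ | n
  · rw [outerCoeff_zero, zero_mul]
  · rw [zero_pow n.succ_ne_zero, mul_zero]

theorem outerGen_pi_div_two (m : ℕ) : outerGen m (Real.pi / 2) = ∑' n, outerCoeff m n := by
  rw [outerGen, show Real.pi / 2 / 2 = Real.pi / 4 by ring, Real.tan_pi_div_four]
  simp

/-- Dividing the coefficients by `n` amounts to integrating against `dy / y = da / sin a`. -/
theorem hasDerivAt_outerGen (m : ℕ) {a : ℝ} (h0 : 0 < a) (ha : a < Real.pi / 2) :
    HasDerivAt (outerGen m) (chainGen (2 * m) a / Real.sin a) a := by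
  have ha' : |a| < Real.pi / 2 := by rwa [abs_of_pos h0]
  have hy := abs_tan_half_lt_one ha'
  have hbd : ∀ n, |outerCoeff m n| ≤ 2 * 2 ^ (2 * m) * ((n : ℝ) + 1) ^ (2 * m) := by
    intro n
    refine le_trans ?_ (abs_signedChainSum_le (2 * m) n)
    rw [outerCoeff, abs_div, Nat.abs_cast]
    rcases Nat.eq_zero_or_pos n with rfl | hn
    · simp
    · exact div_le_self (abs_nonneg _) (by exact_mod_cast hn)
  have hc := (hasDerivAt_tsum_mul_pow hbd hy).1.comp a (hasDerivAt_tan_half ha')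
  convert! hc using 1
  have hF := summable_signedChainSum_mul_pow (2 * m) hy
  rw [chainGen, hF.tsum_eq_zero_add, signedChainSum_zero_right, zero_mul, zero_add,
    Real.sin_eq_two_mul_tan_half_div_one_add_tan_half_sq]
  have hy0 : Real.tan (a / 2) ≠ 0 :=
    (Real.tan_pos_of_pos_of_lt_pi_div_two (by linarith) (by linarith [Real.pi_pos])).ne'
  set y := Real.tan (a / 2)
  have e : ∑' n, signedChainSum (2 * m) (n + 1) * y ^ (n + 1) =
      (∑' n : ℕ, ((n : ℝ) + 1) * outerCoeff m (n + 1) * y ^ n) * y := by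
    rw [← tsum_mul_right]
    refine tsum_congr fun n => ?_
    have : (n : ℝ) + 1 ≠ 0 := by positivity
    rw [outerCoeff]
    push_cast
    field_simp
    ring
  have h1 : 1 + y ^ 2 ≠ 0 := by positivity
  rw [e]
  field_simp

/-- Integrating the closed form of the generating function against `1 / sin a`. -/
theorem tsum_outerCoeff {m : ℕ} (hm : 1 ≤ m) :
    ∑' n, outerCoeff m n = (-1) ^ m * (Real.pi * dirichletBeta (2 * m + 1) -
      2 * ∑ i ∈ Finset.range m, (-1) ^ i * dirichletBeta (2 * (m - i)) *
        ∫ a in (0 : ℝ)..Real.pi / 2, a ^ (2 * i + 1) / (2 * i + 1).factorial / Real.sin a) := by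
  obtain ⟨hi1, hv1⟩ := integral_tsum_oddDirichletKernel hm
  have hi2 : ∀ i ∈ Finset.range m, IntervalIntegrable (fun a : ℝ => (-1) ^ i *
      dirichletBeta (2 * (m - i)) * (a ^ (2 * i + 1) / (2 * i + 1).factorial / Real.sin a))
      MeasureTheory.volume 0 (Real.pi / 2) :=
    fun i _ => (intervalIntegrable_pow_div_sin (2 * i)).const_mul _
  have hi3 := IntervalIntegrable.sum _ hi2
  have hint := ((hi1.const_mul 2).sub (hi3.const_mul 2)).const_mul ((-1) ^ m)
  have h := intervalIntegral.integral_eq_sub_of_hasDerivAt_of_le (f := outerGen m)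
    (by positivity : (0 : ℝ) ≤ Real.pi / 2) (continuousOn_outerGen m) (fun a ha => ?_) hint
  · rw [outerGen_zero, sub_zero, outerGen_pi_div_two, intervalIntegral.integral_const_mul,
      intervalIntegral.integral_sub (hi1.const_mul 2) (hi3.const_mul 2),
      intervalIntegral.integral_const_mul, intervalIntegral.integral_const_mul, hv1] at h
    simp only [Finset.sum_apply] at h
    rw [intervalIntegral.integral_finsetSum hi2] at h
    simp_rw [intervalIntegral.integral_const_mul] at h
    rw [← h]
    ring
  · have hs : Real.sin a ≠ 0 :=
      (Real.sin_pos_of_pos_of_lt_pi ha.1 (by linarith [ha.2, Real.pi_pos])).ne'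
    have hd := hasDerivAt_outerGen m ha.1 ha.2
    convert! hd using 1
    rw [chainGen_two_mul hm ha.1.le ha.2, eq_div_iff hs, Finset.sum_apply, mul_assoc, sub_mul,
      mul_assoc 2, mul_assoc 2, ← tsum_mul_right, Finset.sum_mul]
    congr 3
    · refine tsum_congr fun n => ?_
      rw [mul_assoc, oddDirichletKernel_mul_sin]
      ring
    · refine Finset.sum_congr rfl fun i _ => ?_
      field_simp

/-- The value in a form that involves only one beta value at an odd argument. -/
theorem mtv_eq_beta_even {m : ℕ} (hm : 1 ≤ m) :
    mtv (signs211 m) (args211 m) = Real.pi * dirichletBeta (2 * m + 1) -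
      4 * ∑ i ∈ Finset.range m, ∑ k ∈ Finset.range (i + 1), (-1) ^ k *
        ((Real.pi / 2) ^ (2 * k) / (2 * k).factorial) *
          (dirichletBeta (2 * (m - i)) * dirichletBeta (2 * (i - k) + 2)) := by
  have e : (-1 : ℝ) ^ m * (-1) ^ m = 1 := by rw [← mul_pow]; norm_num
  rw [mtv_eq_tsum_outerCoeff hm, tsum_outerCoeff hm, ← mul_assoc, e, one_mul]
  simp_rw [integral_pow_div_sin, Finset.mul_sum]
  congr 1
  refine Finset.sum_congr rfl fun i _ => Finset.sum_congr rfl fun k hk => ?_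
  have hk' : i = (i - k) + k := by
    have := Finset.mem_range.mp hk
    omega
  have hs : (-1 : ℝ) ^ i * (-1) ^ (i - k) = (-1) ^ k := by
    nth_rewrite 1 [hk']
    rw [pow_add, mul_right_comm, ← mul_pow]
    norm_num
  rw [← hs]
  ring

/-- The products of two beta values at odd arguments add up to a single beta value. -/
theorem sum_dirichletBeta_odd_mul (m : ℕ) :
    ∑ i ∈ Finset.range (m + 1), ∑ k ∈ Finset.range (i + 1), (-1) ^ k *
        ((Real.pi / 2) ^ (2 * k) / (2 * k).factorial) *
          (dirichletBeta (2 * (m - i) + 1) * dirichletBeta (2 * (i - k) + 1)) =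
      Real.pi / 4 * dirichletBeta (2 * m + 1) := by
  have h : ∀ i, ∑ k ∈ Finset.range (i + 1), (-1) ^ k *
        ((Real.pi / 2) ^ (2 * k) / (2 * k).factorial) *
          (dirichletBeta (2 * (m - i) + 1) * dirichletBeta (2 * (i - k) + 1)) =
      dirichletBeta (2 * (m - i) + 1) * ∑ k ∈ Finset.range (i + 1), (-1) ^ k *
        ((Real.pi / 2) ^ (2 * k) / (2 * k).factorial) * dirichletBeta (2 * (i - k) + 1) := by
    intro i
    rw [Finset.mul_sum]
    exact Finset.sum_congr rfl fun k _ => by ring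
  simp_rw [h]
  rw [Finset.sum_range_succ', Finset.sum_eq_zero fun i _ => by rw [sum_dirichletBeta_odd, mul_zero]]
  simp [dirichletBeta_one]
  ring

/-- The sum over `r + p + 2 k = 2 m` splits according to the common parity of `r` and `p`. -/
theorem sum_filter_eq_sum_even_add_sum_odd (m : ℕ) (f : ℕ → ℕ → ℕ → ℝ) :
    ∑ x ∈ Finset.range (2 * m + 1) ×ˢ Finset.range (2 * m + 1) ×ˢ Finset.range (2 * m + 1)
        with x.1 + x.2.1 + 2 * x.2.2 = 2 * m, f x.1 x.2.1 x.2.2 =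
      (∑ i ∈ Finset.range (m + 1), ∑ k ∈ Finset.range (i + 1), f (2 * (m - i)) (2 * (i - k)) k) +
      ∑ i ∈ Finset.range m, ∑ k ∈ Finset.range (i + 1),
        f (2 * (m - i) - 1) (2 * (i - k) + 1) k := by
  rw [← Finset.sum_filter_add_sum_filter_not _ (fun x : ℕ × ℕ × ℕ => Even x.1), Finset.sum_sigma',
    Finset.sum_sigma']
  congr 1
  · refine Finset.sum_nbij' (fun x => (⟨m - x.1 / 2, x.2.2⟩ : (_ : ℕ) × ℕ))
      (fun p => (2 * (m - p.1), 2 * (p.1 - p.2), p.2)) ?_ ?_ ?_ ?_ ?_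
    · rintro ⟨r, p, k⟩ h
      simp [Nat.even_iff] at h ⊢
      omega
    · rintro ⟨i, k⟩ h
      simp [Nat.even_iff] at h ⊢
      omega
    · rintro ⟨r, p, k⟩ h
      simp [Nat.even_iff] at h ⊢
      omega
    · rintro ⟨i, k⟩ h
      simp at h ⊢
      omega
    · rintro ⟨r, p, k⟩ h
      simp only [Finset.mem_filter, Finset.mem_product, Finset.mem_range, Nat.even_iff] at h
      have h1 : 2 * (m - (m - r / 2)) = r := by omega
      have h2 : 2 * (m - r / 2 - k) = p := by omega
      simp only [h1, h2]
  · refine Finset.sum_nbij' (fun x => (⟨m - (x.1 + 1) / 2, x.2.2⟩ : (_ : ℕ) × ℕ))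
      (fun p => (2 * (m - p.1) - 1, 2 * (p.1 - p.2) + 1, p.2)) ?_ ?_ ?_ ?_ ?_
    · rintro ⟨r, p, k⟩ h
      simp [Nat.odd_iff] at h ⊢
      omega
    · rintro ⟨i, k⟩ h
      simp [Nat.odd_iff] at h ⊢
      omega
    · rintro ⟨r, p, k⟩ h
      simp [Nat.odd_iff] at h ⊢
      omega
    · rintro ⟨i, k⟩ h
      simp at h ⊢
      omega
    · rintro ⟨r, p, k⟩ h
      simp only [Finset.mem_filter, Finset.mem_product, Finset.mem_range, Nat.not_even_iff] at h
      have h1 : 2 * (m - (m - (r + 1) / 2)) - 1 = r := by omega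
      have h2 : 2 * (m - (r + 1) / 2 - k) + 1 = p := by omega
      simp only [h1, h2]

theorem mtv_eq_sum {m : ℕ} (hm : 1 ≤ m) :
    mtv (signs211 m) (args211 m) =
      ∑ x ∈ Finset.range (2 * m + 1) ×ˢ Finset.range (2 * m + 1) ×ˢ Finset.range (2 * m + 1)
          with x.1 + x.2.1 + 2 * x.2.2 = 2 * m,
        4 * (-1 : ℝ) ^ (x.1 + x.2.2) * dirichletBeta (x.1 + 1) * dirichletBeta (x.2.1 + 1) *
          (1 / ((2 * x.2.2).factorial : ℝ)) * (Real.pi / 2) ^ (2 * x.2.2) := by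
  rw [sum_filter_eq_sum_even_add_sum_odd m fun r p k => 4 * (-1 : ℝ) ^ (r + k) *
    dirichletBeta (r + 1) * dirichletBeta (p + 1) * (1 / ((2 * k).factorial : ℝ)) *
      (Real.pi / 2) ^ (2 * k), mtv_eq_beta_even hm]
  have h1 := sum_dirichletBeta_odd_mul m
  rw [show Real.pi * dirichletBeta (2 * m + 1) = 4 * (Real.pi / 4 * dirichletBeta (2 * m + 1)) by
    ring, ← h1, sub_eq_add_neg, ← mul_neg]
  simp_rw [← Finset.sum_neg_distrib, Finset.mul_sum]
  congr 1
  · refine Finset.sum_congr rfl fun i _ => Finset.sum_congr rfl fun k _ => ?_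
    rw [pow_add, (even_two_mul (m - i)).neg_one_pow]
    ring
  · refine Finset.sum_congr rfl fun i hi => Finset.sum_congr rfl fun k _ => ?_
    have hi' := Finset.mem_range.mp hi
    have e : 2 * (m - i) - 1 + 1 = 2 * (m - i) := by omega
    have ho : Odd (2 * (m - i) - 1) := ⟨m - i - 1, by omega⟩
    rw [pow_add, ho.neg_one_pow, e]
    ring

/-- In `mtv_eq_beta_even`, the odd beta value is a rational multiple of a power of `π`. -/
theorem mtv_mem_subalgebra {m : ℕ} (hm : 1 ≤ m) {S : Subalgebra ℚ ℝ} (hpi : Real.pi ^ 2 ∈ S)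
    (hbeta : ∀ k, 1 ≤ k → dirichletBeta (2 * k) ∈ S) : mtv (signs211 m) (args211 m) ∈ S := by
  have hrat : ∀ q : ℚ, (q : ℝ) ∈ S := fun q => S.algebraMap_mem q
  rw [mtv_eq_beta_even hm]
  refine S.sub_mem ?_ (S.mul_mem (by exact_mod_cast hrat 4) (S.sum_mem fun i hi =>
    S.sum_mem fun k _ => S.mul_mem ?_ (S.mul_mem (hbeta _ ?_) (hbeta (i - k + 1) (by omega)))))
  · obtain ⟨q, hq⟩ := exists_rat_dirichletBeta_odd m
    have e : Real.pi * dirichletBeta (2 * m + 1) = q * (Real.pi ^ 2) ^ (m + 1) := by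
      rw [hq]
      ring
    rw [e]
    exact S.mul_mem (hrat q) (S.pow_mem hpi _)
  · have e : (-1 : ℝ) ^ k * ((Real.pi / 2) ^ (2 * k) / (2 * k).factorial) =
        (((-1) ^ k * ((1 / 4) ^ k / (2 * k).factorial) : ℚ) : ℝ) * (Real.pi ^ 2) ^ k := by
      rw [pow_mul, div_pow]
      push_cast
      rw [div_pow, div_pow, one_pow]
      norm_num
      ring
    rw [e]
    exact S.mul_mem (hrat _) (S.pow_mem hpi _)
  · have := Finset.mem_range.mp hi
    omega

theorem mainTheorem3 (m : ℕ) (hm : 1 ≤ m) :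
    Summable (fun n : ammvIndex (2 * m + 1) =>
      ammvTerm (mtvParity (2 * m + 1)) (signs211 m) (args211 m) n) ∧
    mtv (signs211 m) (args211 m) =
      ∑ x ∈ Finset.range (2 * m + 1) ×ˢ Finset.range (2 * m + 1) ×ˢ Finset.range (2 * m + 1)
          with x.1 + x.2.1 + 2 * x.2.2 = 2 * m,
        4 * (-1 : ℝ) ^ (x.1 + x.2.2) * dirichletBeta (x.1 + 1) * dirichletBeta (x.2.1 + 1) *
          (1 / ((2 * x.2.2).factorial : ℝ)) * (Real.pi / 2) ^ (2 * x.2.2) ∧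
    mtv (signs211 m) (args211 m) ∈
      Algebra.adjoin ℚ ({Real.pi ^ 2} ∪ {y : ℝ | ∃ k : ℕ, 1 ≤ k ∧ y = dirichletBeta (2 * k)}) ∧
    mtv (signs211 m) (args211 m) ∈
      Algebra.adjoin ℚ ({Real.pi} ∪ {y : ℝ | ∃ k : ℕ, 2 ≤ k ∧ (y : ℂ) = riemannZeta k} ∪
        {y : ℝ | ∃ k : ℕ, 2 ≤ k ∧ y = dirichletBeta k}) := by
  refine ⟨summable_ammvTerm m, mtv_eq_sum hm, mtv_mem_subalgebra hm ?_ fun k hk => ?_,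
    mtv_mem_subalgebra hm (Subalgebra.pow_mem _ ?_ 2) fun k hk => ?_⟩
  · exact Algebra.subset_adjoin (Or.inl rfl)
  · exact Algebra.subset_adjoin (Or.inr ⟨k, hk, rfl⟩)
  · exact Algebra.subset_adjoin (Or.inl (Or.inl rfl))
  · exact Algebra.subset_adjoin (Or.inr ⟨2 * k, by omega, rfl⟩)
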